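/- Let $M$ be a smooth (finite-dimensional, Hausdorff, second countable) manifold and $A \to M$ a smooth vector bundle of finite rank. Let $\mathcal F$ be the bigraded Poisson algebra of functions on the graded symplectic manifold $T^*[2]A[1]$ (fibrewise polynomial in the momenta), with its canonical Poisson bracket $\{\ ,\ \}$ (the big bracket), of bidegree $(-1,-1)$. With base coordinates $x^i$ of bidegree $(0,0)$, fibre coordinates $\xi^a$ on $A[1]$ of bidegree $(0,1)$, and conjugate momenta $p_i$, $\theta_a$ of bidegrees $(1,1)$, $(1,0)$, a section of $\wedge^{k}A\otimes\wedge^{l}A^*$ is an element of bidegree $(k,l)$ of $\mathcal F$. The shifted bidegree of an element of bidegree $(k,l)$ is $(k-1,l-1)$. A Lie algebroid structure on $A$ is an element $\mu \in \mathcal F$ of shifted bidegree $(0,1)$ with $\{\mu,\mu\}=0$; put $[X,Y]_\mu=\{\{X,\mu\},Y\}$ and $d_\mu=\{\mu,\cdot\}$. A Lie bialgebroid structure on $(A,A^*)$ is a pair $(\mu',\gamma)$ of elements of $\mathcal F$ of shifted bidegrees $(0,1)$ and $(1,0)$ with $\{\mu'+\gamma,\mu'+\gamma\}=0$. A bivector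 $\pi\in\Gamma(\wedge^2A)$ is Poisson if $[\pi,\pi]_\mu=0$. A $(1,1)$-tensor $N\in\Gamma(A^*\otimes A)$, acting on sections of $A$ by $NX=\{X,N\}$, is Nijenhuis if $$[NX,NY]_\mu-N\big([NX,Y]_\mu+[X,NY]_\mu\big)+N^2[X,Y]_\mu=0\quad\text{for all } X,Y\in\Gamma(A).$$ Put $\mu_N=\{N,\mu\}$, $\gamma_\pi=\{\pi,\mu\}$ and $$C_\mu(\pi,N)=\{\pi,\{N,\mu\}\}+\{N,\{\pi,\mu\}\}.$$ A bivector $\pi$ and a $(1,1)$-tensor $N$ are compatible if $N\circ\pi^\sharp=\pi^\sharp\circ N^*$ (where $\pi^\sharp\alpha=i_\alpha\pi$) and $C_\mu(\pi,N)=0$. A PN-structure on $(A,\mu)$ is a pair $(\pi,N)$ of a Poisson bivector and a Nijenhuis tensor that are compatible. Theorem. Let $(A,\mu)$ be a Lie algebroid, $N$ a Nijenhuis $(1,1)$-tensor and $\pi$ a Poisson bivector on $(A,\mu)$. (i) $(\mu_N,\gamma_\pi)$ is a Lie bialgebroid structure on $(A,A^*)$ if and only if $\{\mu,C_\mu(\pi,N)\}=0$.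 In particular, if $\pi$ and $N$ are compatible, then $(\mu_N,\gamma_\pi)$ is a Lie bialgebroid structure on $(A,A^*)$. (ii) Suppose that the $d_\mu$-exact $1$-forms $d_\mu f$, $f\in C^\infty(M)$, generate $\Gamma(A^*)$ locally as a $C^\infty(M)$-module, that is, each point of $M$ has a neighbourhood $U$ such that each $\alpha\in\Gamma(A^*)$ agrees on $U$ with a finite sum $\sum_i g_i\,d_\mu f_i$ with $f_i,g_i\in C^\infty(M)$. Then $(\pi,N)$ is a PN-structure on $(A,\mu)$ if and only if $(\mu_N,\gamma_\pi)$ is a Lie bialgebroid structure on $(A,A^*)$. -/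

import Mathlib

set_option linter.unusedSectionVars false

open scoped Manifold ContDiff Topology DirectSum

noncomputable section

namespace BigBracket

/-- A `ℤ`-graded, graded-commutative, associative real algebra with underlying vector space `Ω`. -/
structure GCAlg (Ω : Type*) [AddCommGroup Ω] [Module ℝ Ω] where
  /-- The product; `mul a` is the operator of multiplication by `a` on the left. -/
  mul : Ω →ₗ[ℝ] Ω →ₗ[ℝ] Ω
  mul_assoc : ∀ a b c : Ω, mul (mul a b) c = mul a (mul b c)
  /-- The elements of degree `i`. -/
  deg : ℤ → Submodule ℝ Ω
  mul_mem : ∀ {i j : ℤ} {a b : Ω}, a ∈ deg i → b ∈ deg j → mul a b ∈ deg (i + j)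
  comm : ∀ {i j : ℤ} {a b : Ω}, a ∈ deg i → b ∈ deg j →
    mul a b = (-1 : ℝ) ^ (i * j) • mul b a

namespace GCAlg

variable {Ω : Type*} [AddCommGroup Ω] [Module ℝ Ω] (G : GCAlg Ω)

/-- The linear operators that raise the degree by `s`. -/
def shift (s : ℤ) : Submodule ℝ ((Ω →ₗ[ℝ] Ω)) where
  carrier := {P | ∀ (i : ℤ) (a : Ω), a ∈ G.deg i → P a ∈ G.deg (i + s)}
  add_mem' := fun hP hQ i a ha => (G.deg _).add_mem (hP i a ha) (hQ i a ha)
  zero_mem' := fun _ _ _ => (G.deg _).zero_mem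
  smul_mem' := fun c _ hP i a ha => (G.deg _).smul_mem c (hP i a ha)

/-- The graded commutator `P ∘ Q - (-1)^(s t) Q ∘ P` of operators of degrees `s` and `t`. -/
def gcomm (s t : ℤ) : (Ω →ₗ[ℝ] Ω) →ₗ[ℝ] (Ω →ₗ[ℝ] Ω) →ₗ[ℝ] (Ω →ₗ[ℝ] Ω) :=
  LinearMap.mk₂ ℝ (fun P Q => P ∘ₗ Q - (-1 : ℝ) ^ (s * t) • (Q ∘ₗ P))
    (fun P P' Q => by rw [LinearMap.add_comp, LinearMap.comp_add, smul_add]; abel)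
    (fun c P Q => by rw [LinearMap.smul_comp, LinearMap.comp_smul, smul_sub, smul_comm])
    (fun P Q Q' => by rw [LinearMap.add_comp, LinearMap.comp_add, smul_add]; abel)
    (fun c P Q => by rw [LinearMap.smul_comp, LinearMap.comp_smul, smul_sub, smul_comm])

theorem gcomm_apply (s t : ℤ) (P Q : Ω →ₗ[ℝ] Ω) :
    gcomm s t P Q = P ∘ₗ Q - (-1 : ℝ) ^ (s * t) • (Q ∘ₗ P) := rfl

/-- `G.ordLT k s` consists of the differential operators of order `< k` on the graded-commutative
algebra, of degree `s`: those of order `< 1` are the multiplication operators, and `P` has order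
`< k + 2` if its graded commutators with all multiplication operators have order `< k + 1`. -/
def ordLT : ℕ → ℤ → Submodule ℝ ((Ω →ₗ[ℝ] Ω))
  | 0, _ => ⊥
  | 1, s => (G.deg s).map G.mul
  | k + 2, s =>
    { carrier := {P | P ∈ G.shift s ∧ ∀ (j : ℤ) (a : Ω), a ∈ G.deg j →
        gcomm s j P (G.mul a) ∈ ordLT (k + 1) (s + j)}
      add_mem' := fun hP hQ => ⟨(G.shift s).add_mem hP.1 hQ.1, fun j a ha => by
        rw [map_add, LinearMap.add_apply]
        exact (ordLT (k + 1) (s + j)).add_mem (hP.2 j a ha) (hQ.2 j a ha)⟩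
      zero_mem' := ⟨(G.shift s).zero_mem, fun j a _ => by
        rw [map_zero, LinearMap.zero_apply]
        exact (ordLT (k + 1) (s + j)).zero_mem⟩
      smul_mem' := fun c P hP => ⟨(G.shift s).smul_mem c hP.1, fun j a ha => by
        rw [map_smul, LinearMap.smul_apply]
        exact (ordLT (k + 1) (s + j)).smul_mem c (hP.2 j a ha)⟩ }

theorem ordLT_zero (s : ℤ) : G.ordLT 0 s = ⊥ := by simp [ordLT]

theorem mem_ordLT_one {s : ℤ} {P : (Ω →ₗ[ℝ] Ω)} :
    P ∈ G.ordLT 1 s ↔ ∃ q ∈ G.deg s, G.mul q = P := by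
  simp only [ordLT, Submodule.mem_map]

theorem mem_ordLT_add_two {k : ℕ} {s : ℤ} {P : (Ω →ₗ[ℝ] Ω)} :
    P ∈ G.ordLT (k + 2) s ↔ P ∈ G.shift s ∧ ∀ (j : ℤ) (a : Ω), a ∈ G.deg j →
      gcomm s j P (G.mul a) ∈ G.ordLT (k + 1) (s + j) := by
  simp only [ordLT]
  rfl

theorem gcomm_mulLeft {i j : ℤ} {a b : Ω} (ha : a ∈ G.deg i) (hb : b ∈ G.deg j) :
    gcomm i j (G.mul a) (G.mul b) = 0 := by
  rw [gcomm_apply]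
  ext w
  simp only [LinearMap.sub_apply, LinearMap.comp_apply, LinearMap.smul_apply,
    LinearMap.zero_apply]
  rw [← G.mul_assoc, ← G.mul_assoc, G.comm ha hb, map_smul, LinearMap.smul_apply, sub_self]

theorem ordLT_le_shift (k : ℕ) (s : ℤ) : G.ordLT k s ≤ G.shift s := by
  match k with
  | 0 => rw [ordLT_zero]; exact bot_le
  | 1 =>
    intro P hP
    obtain ⟨q, hq, rfl⟩ := G.mem_ordLT_one.1 hP
    intro i a ha
    rw [add_comm]
    exact G.mul_mem hq ha
  | k + 2 => exact fun P hP => (G.mem_ordLT_add_two.1 hP).1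

theorem ordLT_le_succ (k : ℕ) : ∀ s : ℤ, G.ordLT k s ≤ G.ordLT (k + 1) s := by
  induction k with
  | zero => intro s; rw [ordLT_zero]; exact bot_le
  | succ k ih =>
    intro s P hP
    refine G.mem_ordLT_add_two.2 ⟨G.ordLT_le_shift _ _ hP, fun j a ha => ?_⟩
    match k with
    | 0 =>
      obtain ⟨q, hq, rfl⟩ := G.mem_ordLT_one.1 hP
      rw [G.gcomm_mulLeft hq (ha)]
      exact Submodule.zero_mem _
    | k + 1 => exact ih _ ((G.mem_ordLT_add_two.1 hP).2 j a ha)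

theorem ordLT_mono {k l : ℕ} (h : k ≤ l) (s : ℤ) : G.ordLT k s ≤ G.ordLT l s := by
  induction l, h using Nat.le_induction with
  | base => exact le_rfl
  | succ l _ ih => exact ih.trans (G.ordLT_le_succ l s)

theorem neg_one_zpow_mul_self (n : ℤ) : (-1 : ℝ) ^ n * (-1 : ℝ) ^ n = 1 := by
  rw [← mul_zpow]; simp

theorem gcomm_skew (s t : ℤ) (P Q : Ω →ₗ[ℝ] Ω) :
    gcomm s t P Q = -((-1 : ℝ) ^ (s * t) • gcomm t s Q P) := by
  rw [gcomm_apply, gcomm_apply, smul_sub, smul_smul, mul_comm t s, neg_one_zpow_mul_self, one_smul]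
  abel

theorem gcomm_jacobi (s t j : ℤ) (P Q R : Ω →ₗ[ℝ] Ω) :
    gcomm (s + t) j (gcomm s t P Q) R =
      gcomm s (t + j) P (gcomm t j Q R) +
        (-1 : ℝ) ^ (t * j) • gcomm (s + j) t (gcomm s j P R) Q := by
  simp only [gcomm_apply, add_mul, mul_add, zpow_add₀ (show (-1 : ℝ) ≠ 0 by norm_num),
    mul_comm j t]
  have h1 := neg_one_zpow_mul_self (t * j)
  generalize (-1 : ℝ) ^ (s * t) = x at *
  generalize (-1 : ℝ) ^ (s * j) = y at *
  generalize (-1 : ℝ) ^ (t * j) = z at *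
  ext w
  simp only [LinearMap.sub_apply, LinearMap.add_apply, LinearMap.smul_apply, LinearMap.comp_apply,
    map_sub, map_smul, smul_sub, smul_smul]
  have h2 : z * (x * z) = x := by rw [mul_left_comm, h1, mul_one]
  rw [h2]
  module

theorem gcomm_mem_shift {s t : ℤ} {P Q : (Ω →ₗ[ℝ] Ω)} (hP : P ∈ G.shift s)
    (hQ : Q ∈ G.shift t) : gcomm s t P Q ∈ G.shift (s + t) := by
  intro i a ha
  rw [gcomm_apply]
  refine (G.deg _).sub_mem ?_ ((G.deg _).smul_mem _ ?_)
  · have := hP _ _ (hQ i a ha)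
    rwa [add_assoc, add_comm t s] at this
  · have := hQ _ _ (hP i a ha)
    rwa [add_assoc] at this

/-- The graded commutator of operators of orders `≤ k` and `≤ l` has order `≤ k + l - 1`. -/
theorem gcomm_mem (n : ℕ) : ∀ (k l : ℕ), k + l ≤ n → ∀ (s t : ℤ) (P Q : Ω →ₗ[ℝ] Ω),
    P ∈ G.ordLT k s → Q ∈ G.ordLT l t → gcomm s t P Q ∈ G.ordLT (k + l - 2) (s + t) := by
  induction n with
  | zero =>
    intro k l h s t P Q hP hQ
    obtain rfl : k = 0 := by omega
    rw [ordLT_zero, Submodule.mem_bot] at hP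
    subst hP
    simp
  | succ n ih =>
    intro k l h s t P Q hP hQ
    match k, l with
    | 0, l =>
      rw [ordLT_zero, Submodule.mem_bot] at hP
      subst hP
      simp
    | k, 0 =>
      rw [ordLT_zero, Submodule.mem_bot] at hQ
      subst hQ
      simp
    | 1, 1 =>
      obtain ⟨p, hp, rfl⟩ := G.mem_ordLT_one.1 hP
      obtain ⟨q, hq, rfl⟩ := G.mem_ordLT_one.1 hQ
      rw [G.gcomm_mulLeft hp hq]
      exact Submodule.zero_mem _
    | 1, l + 2 =>
      obtain ⟨p, hp, rfl⟩ := G.mem_ordLT_one.1 hP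
      rw [gcomm_skew, add_comm s t, show 1 + (l + 2) - 2 = l + 1 by omega]
      exact Submodule.neg_mem _ (Submodule.smul_mem _ _ ((G.mem_ordLT_add_two.1 hQ).2 s p hp))
    | k + 2, 1 =>
      obtain ⟨q, hq, rfl⟩ := G.mem_ordLT_one.1 hQ
      exact (G.mem_ordLT_add_two.1 hP).2 t q hq
    | k + 2, l + 2 =>
      rw [show k + 2 + (l + 2) - 2 = k + l + 2 by omega]
      refine G.mem_ordLT_add_two.2 ⟨G.gcomm_mem_shift (G.ordLT_le_shift _ _ hP)
        (G.ordLT_le_shift _ _ hQ), fun j a ha => ?_⟩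
      rw [gcomm_jacobi]
      refine Submodule.add_mem _ ?_ (Submodule.smul_mem _ _ ?_)
      · have := ih (k + 2) (l + 1) (by omega) _ _ _ _ hP ((G.mem_ordLT_add_two.1 hQ).2 j a ha)
        rwa [← add_assoc s t j, show k + 2 + (l + 1) - 2 = k + l + 1 by omega] at this
      · have := ih (k + 1) (l + 2) (by omega) _ _ _ _ ((G.mem_ordLT_add_two.1 hP).2 j a ha) hQ
        rwa [add_right_comm s j t, show k + 1 + (l + 2) - 2 = k + l + 1 by omega] at this

/-- The principal symbols of order `k` and degree `s`: the differential operators of degree `s` and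
order `≤ k`, modulo those of order `≤ k - 1`. -/
def Symb (k : ℕ) (s : ℤ) : Type _ :=
  G.ordLT (k + 1) s ⧸ (G.ordLT k s).comap (G.ordLT (k + 1) s).subtype

instance (k : ℕ) (s : ℤ) : AddCommGroup (G.Symb k s) :=
  inferInstanceAs (AddCommGroup
    (G.ordLT (k + 1) s ⧸ (G.ordLT k s).comap (G.ordLT (k + 1) s).subtype))

instance (k : ℕ) (s : ℤ) : Module ℝ (G.Symb k s) :=
  inferInstanceAs (Module ℝ
    (G.ordLT (k + 1) s ⧸ (G.ordLT k s).comap (G.ordLT (k + 1) s).subtype))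

/-- The class of an operator of order `≤ k` modulo the operators of order `≤ k - 1`. -/
def toSymb (k : ℕ) (s : ℤ) : G.ordLT (k + 1) s →ₗ[ℝ] G.Symb k s :=
  Submodule.mkQ ((G.ordLT k s).comap (G.ordLT (k + 1) s).subtype)

theorem toSymb_eq_zero {k : ℕ} {s : ℤ} {P : G.ordLT (k + 1) s} :
    G.toSymb k s P = 0 ↔ (P : Ω →ₗ[ℝ] Ω) ∈ G.ordLT k s :=
  Submodule.Quotient.mk_eq_zero _

/-- The class of the graded commutator of two operators. -/
def opBracket (k l : ℕ) (s t : ℤ) :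
    G.ordLT (k + 1) s →ₗ[ℝ] G.ordLT (l + 1) t →ₗ[ℝ] G.Symb (k + l - 1) (s + t) :=
  LinearMap.mk₂ ℝ
    (fun P Q => G.toSymb (k + l - 1) (s + t) ⟨gcomm s t P Q,
      G.ordLT_mono (by omega) _ (G.gcomm_mem _ _ _ le_rfl _ _ _ _ P.2 Q.2)⟩)
    (fun P P' Q => by
      rw [← map_add]
      exact congrArg _ (Subtype.ext (by simp)))
    (fun c P Q => by
      rw [← map_smul]
      exact congrArg _ (Subtype.ext (by simp)))
    (fun P Q Q' => by
      rw [← map_add]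
      exact congrArg _ (Subtype.ext (by simp)))
    (fun c P Q => by
      rw [← map_smul]
      exact congrArg _ (Subtype.ext (by simp)))

theorem opBracket_eq_zero_left {k l : ℕ} {s t : ℤ} {P : G.ordLT (k + 1) s}
    (hP : (P : Ω →ₗ[ℝ] Ω) ∈ G.ordLT k s) (Q : G.ordLT (l + 1) t) :
    G.opBracket k l s t P Q = 0 :=
  G.toSymb_eq_zero.2 (G.ordLT_mono (by omega) _ (G.gcomm_mem _ _ _ le_rfl _ _ _ _ hP Q.2))

theorem opBracket_eq_zero_right {k l : ℕ} {s t : ℤ} (P : G.ordLT (k + 1) s)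
    {Q : G.ordLT (l + 1) t} (hQ : (Q : Ω →ₗ[ℝ] Ω) ∈ G.ordLT l t) :
    G.opBracket k l s t P Q = 0 :=
  G.toSymb_eq_zero.2 (G.ordLT_mono (by omega) _ (G.gcomm_mem _ _ _ le_rfl _ _ _ _ P.2 hQ))

/-- The Poisson bracket of two principal symbols: the symbol of the graded commutator. -/
def symbBracket (k l : ℕ) (s t : ℤ) :
    G.Symb k s →ₗ[ℝ] G.Symb l t →ₗ[ℝ] G.Symb (k + l - 1) (s + t) :=
  Submodule.liftQ _
    { toFun := fun P => Submodule.liftQ _ (G.opBracket k l s t P)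
        fun _ hQ => G.opBracket_eq_zero_right P hQ
      map_add' := fun P P' => Submodule.linearMap_qext _ (LinearMap.ext fun Q =>
        LinearMap.congr_fun (map_add (G.opBracket k l s t) P P') Q)
      map_smul' := fun c P => Submodule.linearMap_qext _ (LinearMap.ext fun Q =>
        LinearMap.congr_fun (map_smul (G.opBracket k l s t) c P) Q) }
    fun _ hP => Submodule.linearMap_qext _ (LinearMap.ext fun Q =>
      G.opBracket_eq_zero_left hP Q)

/-- The space of principal symbols, that is, of the functions on the cotangent bundle that are
polynomial in the momenta; the summand with index `(k, s)` consists of the symbols of order `k`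
(the number of momenta) and degree `s`. -/
def SymbAlg : Type _ := ⨁ p : ℕ × ℤ, G.Symb p.1 p.2

instance : AddCommGroup G.SymbAlg :=
  inferInstanceAs (AddCommGroup (⨁ p : ℕ × ℤ, G.Symb p.1 p.2))

instance : Module ℝ G.SymbAlg :=
  inferInstanceAs (Module ℝ (⨁ p : ℕ × ℤ, G.Symb p.1 p.2))

/-- The inclusion of the symbols of order `k` and degree `s`. -/
def incl (k : ℕ) (s : ℤ) : G.Symb k s →ₗ[ℝ] G.SymbAlg :=
  DirectSum.lof ℝ (ℕ × ℤ) (fun p => G.Symb p.1 p.2) (k, s)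

/-- The linear map on the space of principal symbols with given restrictions to the summands. -/
def lift {N : Type*} [AddCommGroup N] [Module ℝ N] (f : ∀ k s, G.Symb k s →ₗ[ℝ] N) :
    G.SymbAlg →ₗ[ℝ] N :=
  DirectSum.toModule ℝ (ℕ × ℤ) N fun p => f p.1 p.2

theorem lift_incl {N : Type*} [AddCommGroup N] [Module ℝ N] (f : ∀ k s, G.Symb k s →ₗ[ℝ] N)
    (k : ℕ) (s : ℤ) (x : G.Symb k s) : G.lift f (G.incl k s x) = f k s x :=
  DirectSum.toModule_lof ℝ (M := fun p : ℕ × ℤ => G.Symb p.1 p.2) (k, s) x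

/-- The canonical Poisson bracket of the cotangent bundle, the bilinear map with
`{u, v} = symbBracket u v` for homogeneous `u` and `v`. -/
def bracket : G.SymbAlg →ₗ[ℝ] G.SymbAlg →ₗ[ℝ] G.SymbAlg :=
  G.lift fun k s => LinearMap.flip <| G.lift fun l t => LinearMap.flip <|
    (G.symbBracket k l s t).compr₂ (G.incl (k + l - 1) (s + t))

instance : Bracket G.SymbAlg G.SymbAlg := ⟨fun u v => G.bracket u v⟩

/-- The principal symbol of order `k` and degree `s` of an operator. -/
def symb (k : ℕ) (s : ℤ) (P : Ω →ₗ[ℝ] Ω) (hP : P ∈ G.ordLT (k + 1) s) : G.SymbAlg :=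
  G.incl k s (G.toSymb k s ⟨P, hP⟩)

/-- The elements of bidegree `(k, l)`, where a symbol of order `k` and degree `s` has bidegree
`(k, k + s)`. -/
def bideg (k : ℕ) (l : ℤ) : Submodule ℝ G.SymbAlg :=
  LinearMap.range (G.incl k (l - k))

/-- The bracket of principal symbols is the symbol of the graded commutator. -/
theorem bracket_symb (k l : ℕ) (s t : ℤ) (P Q : Ω →ₗ[ℝ] Ω) (hP : P ∈ G.ordLT (k + 1) s)
    (hQ : Q ∈ G.ordLT (l + 1) t) :
    ⁅G.symb k s P hP, G.symb l t Q hQ⁆ = G.symb (k + l - 1) (s + t) (gcomm s t P Q)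
      (G.ordLT_mono (by omega) _ (G.gcomm_mem _ _ _ le_rfl _ _ _ _ hP hQ)) := by
  change G.bracket (G.symb k s P hP) (G.symb l t Q hQ) = _
  rw [bracket, symb, symb, lift_incl, LinearMap.flip_apply, lift_incl]
  rfl

end GCAlg

section Pointwise

variable {V W : Type*} [AddCommGroup V] [Module ℝ V] [AddCommGroup W] [Module ℝ W]

/-- The exterior power `⋀^i V` for an integer `i`, which is zero for `i < 0`. -/
def extDeg (V : Type*) [AddCommGroup V] [Module ℝ V] : ℤ → Submodule ℝ (ExteriorAlgebra ℝ V)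
  | Int.ofNat n => ⋀[ℝ]^n V
  | Int.negSucc _ => ⊥

theorem extDeg_natCast (n : ℕ) : extDeg V (n : ℤ) = ⋀[ℝ]^n V := rfl

theorem algebraMap_mem_extDeg (r : ℝ) :
    algebraMap ℝ (ExteriorAlgebra ℝ V) r ∈ extDeg V 0 := by
  change _ ∈ LinearMap.range (ExteriorAlgebra.ι ℝ : V →ₗ[ℝ] _) ^ 0
  rw [pow_zero]
  exact Submodule.algebraMap_mem r

theorem ι_mem_extDeg (v : V) : ExteriorAlgebra.ι ℝ v ∈ extDeg V 1 := by
  change _ ∈ LinearMap.range (ExteriorAlgebra.ι ℝ : V →ₗ[ℝ] _) ^ 1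
  rw [pow_one]
  exact ⟨v, rfl⟩

theorem extDeg_mul {i j : ℤ} {a b : ExteriorAlgebra ℝ V} (ha : a ∈ extDeg V i)
    (hb : b ∈ extDeg V j) : a * b ∈ extDeg V (i + j) := by
  match i, j with
  | Int.negSucc _, j =>
    rw [show a = 0 from ha, zero_mul]
    exact Submodule.zero_mem _
  | i, Int.negSucc _ =>
    rw [show b = 0 from hb, mul_zero]
    exact Submodule.zero_mem _
  | Int.ofNat m, Int.ofNat n =>
    change a * b ∈ LinearMap.range (ExteriorAlgebra.ι ℝ : V →ₗ[ℝ] _) ^ (m + n)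
    rw [pow_add]
    exact Submodule.mul_mem_mul ha hb

/-- Induction on homogeneous elements of the exterior algebra. -/
theorem extDeg_induction {p : ℤ → ExteriorAlgebra ℝ V → Prop}
    (hneg : ∀ i, p i 0) (hadd : ∀ i a b, p i a → p i b → p i (a + b))
    (hc : ∀ r : ℝ, p 0 (algebraMap ℝ _ r))
    (hι : ∀ i v a, a ∈ extDeg V i → p i a → p (i + 1) (ExteriorAlgebra.ι ℝ v * a))
    {i : ℤ} {a : ExteriorAlgebra ℝ V} (ha : a ∈ extDeg V i) : p i a := by
  match i with
  | Int.negSucc _ => rw [show a = 0 from ha]; exact hneg _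
  | Int.ofNat n =>
    induction n generalizing a with
    | zero =>
      change a ∈ LinearMap.range (ExteriorAlgebra.ι ℝ : V →ₗ[ℝ] _) ^ 0 at ha
      rw [pow_zero] at ha
      obtain ⟨r, rfl⟩ := Submodule.mem_one.1 ha
      exact hc r
    | succ n ih =>
      change a ∈ LinearMap.range (ExteriorAlgebra.ι ℝ : V →ₗ[ℝ] _) ^ (n + 1) at ha
      rw [pow_succ'] at ha
      refine Submodule.mul_induction_on ha ?_ (fun x y hx hy => hadd _ _ _ hx hy)
      rintro _ ⟨v, rfl⟩ b hb
      exact hι n v b hb (ih hb)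

theorem ι_comm {j : ℤ} (v : V) {b : ExteriorAlgebra ℝ V} (hb : b ∈ extDeg V j) :
    ExteriorAlgebra.ι ℝ v * b = (-1 : ℝ) ^ j • (b * ExteriorAlgebra.ι ℝ v) := by
  refine extDeg_induction (p := fun j b => ExteriorAlgebra.ι ℝ v * b =
    (-1 : ℝ) ^ j • (b * ExteriorAlgebra.ι ℝ v)) ?_ ?_ ?_ ?_ hb
  · simp
  · intro i a b ha hb
    rw [mul_add, ha, hb, add_mul, smul_add]
  · intro r
    rw [zpow_zero, one_smul, Algebra.commutes]
  · intro i w a _ ih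
    have h : ExteriorAlgebra.ι ℝ v * ExteriorAlgebra.ι ℝ w =
        -(ExteriorAlgebra.ι ℝ w * ExteriorAlgebra.ι ℝ v) :=
      eq_neg_of_add_eq_zero_left (ExteriorAlgebra.ι_add_mul_swap v w)
    rw [← mul_assoc, h, neg_mul, mul_assoc, ih, zpow_add_one₀ (by norm_num), mul_smul_comm,
      mul_neg_one, neg_smul, mul_assoc]

theorem extDeg_comm {i j : ℤ} {a b : ExteriorAlgebra ℝ V} (ha : a ∈ extDeg V i)
    (hb : b ∈ extDeg V j) : a * b = (-1 : ℝ) ^ (i * j) • (b * a) := by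
  refine extDeg_induction (p := fun i a => a * b = (-1 : ℝ) ^ (i * j) • (b * a)) ?_ ?_ ?_ ?_ ha
  · simp
  · intro i a b ha hb
    rw [mul_add, add_mul, ha, hb, smul_add]
  · intro r
    rw [zero_mul, zpow_zero, one_smul, Algebra.commutes]
  · intro i w a _ ih
    rw [mul_assoc, ih, mul_smul_comm, ← mul_assoc, ι_comm w hb, smul_mul_assoc, smul_smul,
      mul_assoc, add_mul, one_mul, zpow_add₀ (by norm_num)]

/-- The interior product of the exterior algebra of `V` with the exterior algebra of `W`, for a
pairing of `V` and `W`: the algebra homomorphism that sends a vector `v` to the contraction with `v`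
(so that `v ∧ w` is sent to `i_v ∘ i_w`). -/
def intProd (B : V →ₗ[ℝ] Module.Dual ℝ W) :
    ExteriorAlgebra ℝ V →ₐ[ℝ] Module.End ℝ (ExteriorAlgebra ℝ W) :=
  ExteriorAlgebra.lift ℝ ⟨CliffordAlgebra.contractLeft.comp B, fun v =>
    LinearMap.ext fun x => CliffordAlgebra.contractLeft_contractLeft (B v) x⟩

theorem intProd_ι (B : V →ₗ[ℝ] Module.Dual ℝ W) (v : V) (x : ExteriorAlgebra ℝ W) :
    intProd B (ExteriorAlgebra.ι ℝ v) x = CliffordAlgebra.contractLeft (B v) x := by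
  rw [intProd, ExteriorAlgebra.lift_ι_apply]
  rfl

theorem contract_mem (d : Module.Dual ℝ W) {i : ℤ} {a : ExteriorAlgebra ℝ W}
    (ha : a ∈ extDeg W i) : CliffordAlgebra.contractLeft d a ∈ extDeg W (i - 1) := by
  refine extDeg_induction (p := fun i a => CliffordAlgebra.contractLeft d a ∈ extDeg W (i - 1))
    ?_ ?_ ?_ ?_ ha
  · intro i
    rw [map_zero]
    exact Submodule.zero_mem _
  · intro i a b ha hb
    rw [map_add]
    exact Submodule.add_mem _ ha hb
  · intro r
    rw [CliffordAlgebra.contractLeft_algebraMap]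
    exact Submodule.zero_mem _
  · intro i w a ha ih
    rw [ExteriorAlgebra.ι, CliffordAlgebra.contractLeft_ι_mul, add_sub_cancel_right]
    refine Submodule.sub_mem _ (Submodule.smul_mem _ _ ha) ?_
    have := extDeg_mul (ι_mem_extDeg w) ih
    rwa [add_sub_cancel] at this

theorem contract_mul (d : Module.Dual ℝ W) {i : ℤ} {a : ExteriorAlgebra ℝ W}
    (ha : a ∈ extDeg W i) (b : ExteriorAlgebra ℝ W) :
    CliffordAlgebra.contractLeft d (a * b) = CliffordAlgebra.contractLeft d a * b +
      (-1 : ℝ) ^ i • (a * CliffordAlgebra.contractLeft d b) := by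
  refine extDeg_induction (p := fun i a => CliffordAlgebra.contractLeft d (a * b) =
    CliffordAlgebra.contractLeft d a * b +
      (-1 : ℝ) ^ i • (a * CliffordAlgebra.contractLeft d b)) ?_ ?_ ?_ ?_ ha
  · simp
  · intro i a b ha hb
    rw [add_mul, map_add, ha, hb, map_add, add_mul, add_mul, smul_add]
    abel
  · intro r
    rw [CliffordAlgebra.contractLeft_algebraMap, CliffordAlgebra.contractLeft_algebraMap_mul,
      zero_mul, zero_add, zpow_zero, one_smul]
  · intro i w a ha ih
    rw [ExteriorAlgebra.ι, mul_assoc, CliffordAlgebra.contractLeft_ι_mul, ih,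
      CliffordAlgebra.contractLeft_ι_mul, zpow_add_one₀ (by norm_num), mul_add, sub_mul,
      mul_smul_comm, smul_mul_assoc, mul_neg_one, neg_smul, mul_assoc, mul_assoc]
    abel

/-- The algebra homomorphism `a ↦ a + ε D a`, where `D` is the derivation of degree zero of the
exterior algebra that extends the endomorphism `T`. -/
def extDual (T : W →ₗ[ℝ] W) :
    ExteriorAlgebra ℝ W →ₐ[ℝ] TrivSqZeroExt (ExteriorAlgebra ℝ W) (ExteriorAlgebra ℝ W) :=
  ExteriorAlgebra.lift ℝ
    ⟨((TrivSqZeroExt.inlAlgHom ℝ (ExteriorAlgebra ℝ W) (ExteriorAlgebra ℝ W)).toLinearMap ∘ₗ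
        ExteriorAlgebra.ι ℝ) +
      ((TrivSqZeroExt.inrHom (ExteriorAlgebra ℝ W) (ExteriorAlgebra ℝ W)).restrictScalars ℝ ∘ₗ
        ExteriorAlgebra.ι ℝ ∘ₗ T), fun w => by
        ext
        · simp
        · simp⟩

/-- The derivation of degree zero of the exterior algebra that extends the endomorphism `T`. -/
def extDer (T : W →ₗ[ℝ] W) : ExteriorAlgebra ℝ W →ₗ[ℝ] ExteriorAlgebra ℝ W :=
  (TrivSqZeroExt.sndHom (ExteriorAlgebra ℝ W) (ExteriorAlgebra ℝ W)).restrictScalars ℝ ∘ₗ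
    (extDual T).toLinearMap

theorem fst_lift_extDer (T : W →ₗ[ℝ] W) (a : ExteriorAlgebra ℝ W) :
    (extDual T a).fst = a := by
  have : (TrivSqZeroExt.fstHom ℝ (ExteriorAlgebra ℝ W) (ExteriorAlgebra ℝ W)).comp (extDual T) =
      AlgHom.id ℝ _ := by
    ext w
    simp [extDual]
  exact DFunLike.congr_fun this a

theorem extDer_ι (T : W →ₗ[ℝ] W) (w : W) :
    extDer T (ExteriorAlgebra.ι ℝ w) = ExteriorAlgebra.ι ℝ (T w) := by
  change (extDual T (ExteriorAlgebra.ι ℝ w)).snd = _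
  simp [extDual]

theorem extDer_algebraMap (T : W →ₗ[ℝ] W) (r : ℝ) :
    extDer T (algebraMap ℝ _ r) = 0 := by
  change (extDual T (algebraMap ℝ _ r)).snd = _
  rw [AlgHom.commutes]
  rfl

theorem extDer_mul (T : W →ₗ[ℝ] W) (a b : ExteriorAlgebra ℝ W) :
    extDer T (a * b) = extDer T a * b + a * extDer T b := by
  change (extDual T (a * b)).snd = (extDual T a).snd * b + a * (extDual T b).snd
  rw [map_mul, TrivSqZeroExt.snd_mul, fst_lift_extDer, fst_lift_extDer, add_comm]
  rfl

theorem extDer_mem (T : W →ₗ[ℝ] W) {i : ℤ} {a : ExteriorAlgebra ℝ W} (ha : a ∈ extDeg W i) :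
    extDer T a ∈ extDeg W i := by
  refine extDeg_induction (p := fun i a => extDer T a ∈ extDeg W i) ?_ ?_ ?_ ?_ ha
  · intro i
    rw [map_zero]
    exact Submodule.zero_mem _
  · intro i a b ha hb
    rw [map_add]
    exact Submodule.add_mem _ ha hb
  · intro r
    rw [extDer_algebraMap]
    exact Submodule.zero_mem _
  · intro i w a ha ih
    rw [extDer_mul, extDer_ι, add_comm i 1]
    exact Submodule.add_mem _ (extDeg_mul (ι_mem_extDeg _) ha) (extDeg_mul (ι_mem_extDeg _) ih)

theorem exteriorPower_two_induction {p : ExteriorAlgebra ℝ V → Prop}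
    (hadd : ∀ a b, p a → p b → p (a + b))
    (hι : ∀ v w, p (ExteriorAlgebra.ι ℝ v * ExteriorAlgebra.ι ℝ w))
    {a : ExteriorAlgebra ℝ V} (ha : a ∈ ⋀[ℝ]^2 V) : p a := by
  change a ∈ LinearMap.range (ExteriorAlgebra.ι ℝ : V →ₗ[ℝ] _) ^ 2 at ha
  rw [pow_two] at ha
  refine Submodule.mul_induction_on ha ?_ hadd
  rintro _ ⟨v, rfl⟩ _ ⟨w, rfl⟩
  exact hι v w

theorem intProd_two_mem (B : V →ₗ[ℝ] Module.Dual ℝ W) {P : ExteriorAlgebra ℝ V}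
    (hP : P ∈ ⋀[ℝ]^2 V) {i : ℤ} {a : ExteriorAlgebra ℝ W} (ha : a ∈ extDeg W i) :
    intProd B P a ∈ extDeg W (i + (-2)) := by
  refine exteriorPower_two_induction (p := fun P => intProd B P a ∈ extDeg W (i + (-2))) ?_ ?_ hP
  · intro P Q h h'
    rw [map_add]
    exact Submodule.add_mem _ h h'
  · intro v w
    rw [map_mul, Module.End.mul_apply, intProd_ι, intProd_ι]
    have := contract_mem (B v) (contract_mem (B w) ha)
    rwa [sub_sub, show (1 : ℤ) + 1 = 2 from rfl, sub_eq_add_neg] at this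

/-- The interior product with a bivector is a differential operator of order two. -/
theorem intProd_two_order (B : V →ₗ[ℝ] Module.Dual ℝ W) {P : ExteriorAlgebra ℝ V}
    (hP : P ∈ ⋀[ℝ]^2 V) {i j : ℤ} {a b : ExteriorAlgebra ℝ W} (ha : a ∈ extDeg W i)
    (hb : b ∈ extDeg W j) (y : ExteriorAlgebra ℝ W) :
    intProd B P (a * (b * y)) - (-1 : ℝ) ^ (-2 * i) • (a * intProd B P (b * y)) -
      (-1 : ℝ) ^ ((-2 + i) * j) •
        (b * (intProd B P (a * y) - (-1 : ℝ) ^ (-2 * i) • (a * intProd B P y))) =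
    (intProd B P (a * (b * 1)) - (-1 : ℝ) ^ (-2 * i) • (a * intProd B P (b * 1)) -
      (-1 : ℝ) ^ ((-2 + i) * j) •
        (b * (intProd B P (a * 1) - (-1 : ℝ) ^ (-2 * i) • (a * intProd B P 1)))) * y := by
  have e2 : ∀ n : ℤ, (-1 : ℝ) ^ (-2 * n) = 1 := fun n => by
    rw [zpow_mul]; norm_num
  have ei : (-1 : ℝ) ^ i * (-1 : ℝ) ^ i = 1 := by rw [← mul_zpow]; simp
  have ej : (-1 : ℝ) ^ j * (-1 : ℝ) ^ j = 1 := by rw [← mul_zpow]; simp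
  suffices h : ∀ y, intProd B P (a * (b * y)) - (a * intProd B P (b * y)) -
      (-1 : ℝ) ^ (i * j) • (b * (intProd B P (a * y) - (a * intProd B P y))) =
      (intProd B P (a * b) - (a * intProd B P b) -
      (-1 : ℝ) ^ (i * j) • (b * (intProd B P a - (a * intProd B P 1)))) * y by
    have e3 : (-1 : ℝ) ^ ((-2 + i) * j) = (-1 : ℝ) ^ (i * j) := by
      rw [add_mul, zpow_add₀ (by norm_num), e2, one_mul]
    rw [e3, e2]
    simpa using h y
  intro y
  refine exteriorPower_two_induction (p := fun P =>
      intProd B P (a * (b * y)) - (a * intProd B P (b * y)) -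
      (-1 : ℝ) ^ (i * j) • (b * (intProd B P (a * y) - (a * intProd B P y))) =
      (intProd B P (a * b) - (a * intProd B P b) -
      (-1 : ℝ) ^ (i * j) • (b * (intProd B P a - (a * intProd B P 1)))) * y) ?_ ?_ hP
  · intro P Q hP hQ
    simp only [map_add, LinearMap.add_apply]
    rw [show ∀ p1 p2 p3 p4 q1 q2 q3 q4 : ExteriorAlgebra ℝ W, (p1 + q1) - a * (p2 + q2) -
      (-1 : ℝ) ^ (i * j) • (b * ((p3 + q3) - a * (p4 + q4))) = (p1 - a * p2 -
      (-1 : ℝ) ^ (i * j) • (b * (p3 - a * p4))) + (q1 - a * q2 -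
      (-1 : ℝ) ^ (i * j) • (b * (q3 - a * q4))) from fun p1 p2 p3 p4 q1 q2 q3 q4 => by
        simp only [mul_add, mul_sub, smul_add, smul_sub]; abel, hP, hQ, ← add_mul]
    congr 1
    simp only [mul_add, mul_sub, smul_add, smul_sub]
    abel
  · intro v w
    simp only [map_mul, Module.End.mul_apply, intProd_ι]
    have hva := contract_mem (B v) ha
    have hwa := contract_mem (B w) ha
    have hvwa := contract_mem (B v) hwa
    have k1 : ∀ z, CliffordAlgebra.contractLeft (B v) (CliffordAlgebra.contractLeft (B w) (a * z)) =
        CliffordAlgebra.contractLeft (B v) (CliffordAlgebra.contractLeft (B w) a) * z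
        + (-1 : ℝ) ^ i • (CliffordAlgebra.contractLeft (B v) a * CliffordAlgebra.contractLeft (B w) z
          - CliffordAlgebra.contractLeft (B w) a * CliffordAlgebra.contractLeft (B v) z)
        + a * CliffordAlgebra.contractLeft (B v) (CliffordAlgebra.contractLeft (B w) z) := by
      intro z
      rw [contract_mul _ ha, map_add, contract_mul _ hwa, map_smul, contract_mul _ ha,
        zpow_sub_one₀ (by norm_num), smul_add, smul_smul, ei, one_smul, smul_sub]
      norm_num
      abel
    have c0 : CliffordAlgebra.contractLeft (B v) (CliffordAlgebra.contractLeft (B w) a) * b =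
        (-1 : ℝ) ^ (i * j) •
          (b * CliffordAlgebra.contractLeft (B v) (CliffordAlgebra.contractLeft (B w) a)) := by
      rw [extDeg_comm hvwa hb, show (i - 1 - 1) * j = -2 * j + i * j by ring,
        zpow_add₀ (by norm_num), e2, one_mul]
    have c1 : ∀ u : V, CliffordAlgebra.contractLeft (B u) a * b =
        (-1 : ℝ) ^ (i * j) • (-1 : ℝ) ^ j • (b * CliffordAlgebra.contractLeft (B u) a) := by
      intro u
      rw [extDeg_comm (contract_mem (B u) ha) hb, sub_mul, one_mul, zpow_sub₀ (by norm_num),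
        smul_smul, div_eq_mul_inv]
      congr 2
      exact inv_eq_of_mul_eq_one_left ej
    rw [k1, k1, k1, contract_mul _ hb, contract_mul _ hb, CliffordAlgebra.contractLeft_one,
      map_zero, mul_zero, sub_zero]
    generalize CliffordAlgebra.contractLeft (B v) (CliffordAlgebra.contractLeft (B w) a) = vwa at *
    have c1v := c1 v
    have c1w := c1 w
    generalize CliffordAlgebra.contractLeft (B v) a = va at *
    generalize CliffordAlgebra.contractLeft (B w) a = wa at *
    generalize CliffordAlgebra.contractLeft (B v) b = vb at *
    generalize CliffordAlgebra.contractLeft (B w) b = wb at *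
    generalize CliffordAlgebra.contractLeft (B v) (CliffordAlgebra.contractLeft (B w) b) = vwb at *
    generalize CliffordAlgebra.contractLeft (B v) y = vy at *
    generalize CliffordAlgebra.contractLeft (B w) y = wy at *
    have d1 : ∀ z, va * (b * z) = (-1 : ℝ) ^ (i * j) • (-1 : ℝ) ^ j • (b * (va * z)) := fun z => by
      rw [← mul_assoc, c1v, smul_mul_assoc, smul_mul_assoc, mul_assoc]
    have d2 : ∀ z, wa * (b * z) = (-1 : ℝ) ^ (i * j) • (-1 : ℝ) ^ j • (b * (wa * z)) := fun z => by
      rw [← mul_assoc, c1w, smul_mul_assoc, smul_mul_assoc, mul_assoc]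
    have d3 : ∀ z, vwa * (b * z) = (-1 : ℝ) ^ (i * j) • (b * (vwa * z)) := fun z => by
      rw [← mul_assoc, c0, smul_mul_assoc, mul_assoc]
    simp only [mul_add, mul_sub, add_mul, sub_mul, smul_add, smul_sub, mul_smul_comm,
      smul_mul_assoc, mul_assoc, d1, d2, d3, c0, add_sub_cancel_right]
    generalize (-1 : ℝ) ^ j = u at *
    generalize (-1 : ℝ) ^ i = t at *
    generalize (-1 : ℝ) ^ (i * j) = r at *
    simp only [smul_smul]
    rw [show u * (r * u) = r by rw [mul_left_comm, ej, mul_one]]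
    module

end Pointwise

section Geometry

variable {E H M : Type*} [NormedAddCommGroup E] [NormedSpace ℝ E] [TopologicalSpace H]
  (I : ModelWithCorners ℝ E H) [TopologicalSpace M] [ChartedSpace H M]

section Sections

variable (G : Type*) [NormedAddCommGroup G] [NormedSpace ℝ G] (B : M → Type*)
  [∀ x, AddCommGroup (B x)] [∀ x, Module ℝ (B x)] [TopologicalSpace (Bundle.TotalSpace G B)]
  [∀ x, TopologicalSpace (B x)] [FiberBundle G B]

/-- A function, as a section of the exterior bundle of `B`. -/
def fnSec (f : C^∞⟮I, M; ℝ⟯) : (x : M) → ExteriorAlgebra ℝ (B x) :=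
  fun x => algebraMap ℝ _ (f x)

/-- A section of `B`, as a section of the exterior bundle of `B`. -/
def vecSec (X : Cₛ^∞⟮I; G, B⟯) : (x : M) → ExteriorAlgebra ℝ (B x) :=
  fun x => ExteriorAlgebra.ι ℝ (X x)

/-- The sections of the exterior bundle of `B` that are polynomials in smooth functions and
smooth sections of `B`. -/
def polySec : Subalgebra ℝ ((x : M) → ExteriorAlgebra ℝ (B x)) :=
  Algebra.adjoin ℝ (Set.range (fnSec I B) ∪ Set.range (vecSec I G B))

/-- The smooth sections of the exterior bundle of `B`: those which near each point are polynomials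
in smooth functions and smooth sections of `B`. -/
def extSec : Submodule ℝ ((x : M) → ExteriorAlgebra ℝ (B x)) where
  carrier := {u | ∀ x, ∃ η ∈ polySec I G B, ∀ᶠ y in 𝓝 x, u y = η y}
  add_mem' := fun {a b} ha hb x => by
    obtain ⟨η, hη, h⟩ := ha x
    obtain ⟨η', hη', h'⟩ := hb x
    refine ⟨η + η', add_mem hη hη', ?_⟩
    filter_upwards [h, h'] with y hy hy'
    rw [Pi.add_apply, Pi.add_apply, hy, hy']
  zero_mem' := fun x => ⟨0, zero_mem _, Filter.Eventually.of_forall fun _ => rfl⟩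
  smul_mem' := fun c a ha x => by
    obtain ⟨η, hη, h⟩ := ha x
    refine ⟨c • η, Subalgebra.smul_mem _ hη c, ?_⟩
    filter_upwards [h] with y hy
    rw [Pi.smul_apply, Pi.smul_apply, hy]

variable {I G B}

theorem polySec_le {η : (x : M) → ExteriorAlgebra ℝ (B x)} (hη : η ∈ polySec I G B) :
    η ∈ extSec I G B :=
  fun _ => ⟨η, hη, Filter.Eventually.of_forall fun _ => rfl⟩

theorem fnSec_mem (f : C^∞⟮I, M; ℝ⟯) : fnSec I B f ∈ polySec I G B :=
  Algebra.subset_adjoin (Or.inl ⟨f, rfl⟩)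

theorem vecSec_mem (X : Cₛ^∞⟮I; G, B⟯) : vecSec I G B X ∈ polySec I G B :=
  Algebra.subset_adjoin (Or.inr ⟨X, rfl⟩)

theorem extSec_mul {a b : (x : M) → ExteriorAlgebra ℝ (B x)} (ha : a ∈ extSec I G B)
    (hb : b ∈ extSec I G B) : a * b ∈ extSec I G B := fun x => by
  obtain ⟨η, hη, h⟩ := ha x
  obtain ⟨η', hη', h'⟩ := hb x
  refine ⟨η * η', mul_mem hη hη', ?_⟩
  filter_upwards [h, h'] with y hy hy'
  rw [Pi.mul_apply, Pi.mul_apply, hy, hy']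

theorem polySec_induction {p : ((x : M) → ExteriorAlgebra ℝ (B x)) → Prop}
    (hadd : ∀ a b, p a → p b → p (a + b)) (hsmul : ∀ (c : ℝ) a, p a → p (c • a)) (h1 : p 1)
    (hf : ∀ (f : C^∞⟮I, M; ℝ⟯) a, a ∈ polySec I G B → p a → p (fnSec I B f * a))
    (hX : ∀ (X : Cₛ^∞⟮I; G, B⟯) a, a ∈ polySec I G B → p a → p (vecSec I G B X * a))
    {a : (x : M) → ExteriorAlgebra ℝ (B x)} (ha : a ∈ polySec I G B) : p a := by
  rw [polySec, ← Subalgebra.mem_toSubmodule, Algebra.adjoin_eq_span] at ha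
  refine Submodule.span_induction ?_ ?_ (fun a b _ _ => hadd a b) (fun c a _ => hsmul c a) ha
  · intro a ha
    have : p a ∧ a ∈ polySec I G B := by
      refine Submonoid.closure_induction_left ⟨h1, one_mem _⟩ ?_ ha
      rintro _ (⟨f, rfl⟩ | ⟨X, rfl⟩) y _ ⟨hy, hy'⟩
      · exact ⟨hf f y hy' hy, mul_mem (fnSec_mem f) hy'⟩
      · exact ⟨hX X y hy' hy, mul_mem (vecSec_mem X) hy'⟩
    exact this.1
  · simpa using hsmul 0 _ h1

variable (I G B)

/-- The graded-commutative algebra of smooth sections of the exterior bundle of `B`. -/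
def extAlg : GCAlg (extSec I G B) where
  mul := LinearMap.mk₂ ℝ (fun a b => ⟨a.1 * b.1, extSec_mul a.2 b.2⟩)
    (fun a a' b => Subtype.ext (add_mul a.1 a'.1 b.1))
    (fun c a b => Subtype.ext (smul_mul_assoc c a.1 b.1))
    (fun a b b' => Subtype.ext (mul_add a.1 b.1 b'.1))
    (fun c a b => Subtype.ext (mul_smul_comm c a.1 b.1))
  mul_assoc := fun a b c => Subtype.ext (mul_assoc a.1 b.1 c.1)
  deg := fun i =>
    { carrier := {a | ∀ x, a.1 x ∈ extDeg (B x) i}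
      add_mem' := fun ha hb x => Submodule.add_mem _ (ha x) (hb x)
      zero_mem' := fun _ => Submodule.zero_mem _
      smul_mem' := fun c _ ha x => Submodule.smul_mem _ c (ha x) }
  mul_mem := fun ha hb x => extDeg_mul (ha x) (hb x)
  comm := fun ha hb => Subtype.ext (funext fun x => extDeg_comm (ha x) (hb x))

end Sections

variable (F : Type*) [NormedAddCommGroup F] [NormedSpace ℝ F] (A : M → Type*) [∀ x, AddCommGroup (A x)]
  [∀ x, Module ℝ (A x)] [TopologicalSpace (Bundle.TotalSpace F A)] [∀ x, TopologicalSpace (A x)]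
  [∀ x, IsTopologicalAddGroup (A x)] [∀ x, ContinuousSMul ℝ (A x)]
  [FiberBundle F A] [VectorBundle ℝ F A]

/-- The smooth sections of `A`. -/
abbrev Vec : Type _ := Cₛ^∞⟮I; F, A⟯

/-- The `1`-forms on `A`: the smooth sections of the dual bundle `A*`. -/
abbrev OneForm : Type _ := Cₛ^∞⟮I; F →L[ℝ] ℝ, fun x => A x →L[ℝ] ℝ⟯

/-- The `(1,1)`-tensors on `A`, as smooth sections of the bundle of endomorphisms of `A`. -/
abbrev EndTensor : Type _ := Cₛ^∞⟮I; F →L[ℝ] F, fun x => A x →L[ℝ] A x⟯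

/-- The bivectors on `A`: the smooth sections of `⋀² A`. -/
structure Bivector where
  /-- The value at a point. -/
  val : (x : M) → ExteriorAlgebra ℝ (A x)
  smooth : val ∈ extSec I F A
  mem : ∀ x, val x ∈ ⋀[ℝ]^2 (A x)

/-- The forms on `A`: the smooth sections of the exterior bundle of the dual bundle `A*`. -/
abbrev Form : Submodule ℝ ((x : M) → ExteriorAlgebra ℝ (A x →L[ℝ] ℝ)) :=
  extSec I (F →L[ℝ] ℝ) (fun x => A x →L[ℝ] ℝ)

/-- The graded-commutative algebra of forms on `A`. -/
abbrev formAlg : GCAlg (Form I F A) :=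
  extAlg I (F →L[ℝ] ℝ) (fun x => A x →L[ℝ] ℝ)

variable {I F A}

/-- The pairing of a vector with covectors. -/
def evalAt (x : M) : A x →ₗ[ℝ] Module.Dual ℝ (A x →L[ℝ] ℝ) where
  toFun v :=
    { toFun := fun α => α v
      map_add' := fun _ _ => rfl
      map_smul' := fun _ _ => rfl }
  map_add' v w := LinearMap.ext fun α => map_add α v w
  map_smul' c v := LinearMap.ext fun α => map_smul α c v

/-- The interior product of forms on `A` with a multivector on `A`. -/
def interiorSec (P : (x : M) → ExteriorAlgebra ℝ (A x))
    (u : (x : M) → ExteriorAlgebra ℝ (A x →L[ℝ] ℝ)) :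
    (x : M) → ExteriorAlgebra ℝ (A x →L[ℝ] ℝ) :=
  fun x => intProd (evalAt x) (P x) (u x)

variable [ContMDiffVectorBundle ∞ F A I]

/-- The pairing of a `1`-form with a section of `A`. -/
def pairing (α : OneForm I F A) (X : Vec I F A) : C^∞⟮I, M; ℝ⟯ :=
  ⟨fun x => α x (X x), fun x => by
    have h : ContMDiffAt I (I.prod 𝓘(ℝ)) ∞
        (fun y => Bundle.TotalSpace.mk' ℝ (E := Bundle.Trivial M ℝ) y (α y (X y))) x :=
      (α.contMDiff x).clm_bundle_apply (X.contMDiff x)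
    rw [Bundle.contMDiffAt_totalSpace] at h
    exact h.2⟩

/-- The action on `1`-forms of the transpose of a `(1,1)`-tensor. -/
def transpose (N : EndTensor I F A) (α : OneForm I F A) : OneForm I F A :=
  ⟨fun x => (α x).comp (N x), fun x => by
    have hα := α.contMDiff x
    have hN := N.contMDiff x
    rw [contMDiffAt_hom_bundle] at hα hN ⊢
    refine ⟨contMDiffAt_id, (hα.2.clm_comp hN.2).congr_of_eventuallyEq ?_⟩
    filter_upwards [(trivializationAt F A x).open_baseSet.mem_nhds
      (FiberBundle.mem_baseSet_trivializationAt' x)] with y hy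
    ext v
    have hy' : y ∈ (trivializationAt ℝ (Bundle.Trivial M ℝ) x).baseSet := Set.mem_univ y
    erw [ContinuousLinearMap.inCoordinates_eq hy hy', ContinuousLinearMap.inCoordinates_eq hy hy',
      ContinuousLinearMap.inCoordinates_eq hy hy]
    simp [Bundle.Trivialization.symm_apply_apply_mk _ hy]⟩

theorem interiorSec_vecSec (X : Vec I F A) (u : (x : M) → ExteriorAlgebra ℝ (A x →L[ℝ] ℝ))
    (x : M) : interiorSec (vecSec I F A X) u x =
      CliffordAlgebra.contractLeft (evalAt x (X x)) (u x) :=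
  intProd_ι _ _ _

theorem interiorSec_poly_vec (X : Vec I F A) {u : (x : M) → ExteriorAlgebra ℝ (A x →L[ℝ] ℝ)}
    (hu : u ∈ polySec I (F →L[ℝ] ℝ) (fun x => A x →L[ℝ] ℝ)) :
    interiorSec (vecSec I F A X) u ∈ polySec I (F →L[ℝ] ℝ) (fun x => A x →L[ℝ] ℝ) := by
  refine polySec_induction (p := fun u => interiorSec (vecSec I F A X) u ∈
    polySec I (F →L[ℝ] ℝ) (fun x => A x →L[ℝ] ℝ)) ?_ ?_ ?_ ?_ ?_ hu
  · intro a b ha hb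
    have : interiorSec (vecSec I F A X) (a + b) =
        interiorSec (vecSec I F A X) a + interiorSec (vecSec I F A X) b :=
      funext fun x => map_add _ _ _
    rw [this]
    exact add_mem ha hb
  · intro c a ha
    have : interiorSec (vecSec I F A X) (c • a) = c • interiorSec (vecSec I F A X) a :=
      funext fun x =>
      map_smul (intProd (evalAt x) (vecSec I F A X x)) c (a x)
    rw [this]
    exact Subalgebra.smul_mem _ ha c
  · have : interiorSec (vecSec I F A X) 1 = 0 := funext fun x => by
      rw [interiorSec_vecSec]
      exact CliffordAlgebra.contractLeft_one _ (evalAt x (X x))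
    rw [this]
    exact zero_mem _
  · intro f a _ ha
    have : interiorSec (vecSec I F A X) (fnSec I _ f * a) =
        fnSec I _ f * interiorSec (vecSec I F A X) a := funext fun x => by
      rw [interiorSec_vecSec, Pi.mul_apply, Pi.mul_apply, interiorSec_vecSec, fnSec,
        CliffordAlgebra.contractLeft_algebraMap_mul]
    rw [this]
    exact mul_mem (fnSec_mem f) ha
  · intro α a ha' ha
    have : interiorSec (vecSec I F A X) (vecSec I _ _ α * a) =
        fnSec I _ (pairing α X) * a - vecSec I _ _ α * interiorSec (vecSec I F A X) a :=
      funext fun x => by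
        rw [interiorSec_vecSec, Pi.sub_apply, Pi.mul_apply, Pi.mul_apply, Pi.mul_apply,
          interiorSec_vecSec, vecSec, ExteriorAlgebra.ι, CliffordAlgebra.contractLeft_ι_mul,
          Algebra.smul_def]
        rfl
    rw [this]
    exact sub_mem (mul_mem (fnSec_mem _) ha') (mul_mem (vecSec_mem α) ha)

theorem interiorSec_poly {P : (x : M) → ExteriorAlgebra ℝ (A x)} (hP : P ∈ polySec I F A)
    {u : (x : M) → ExteriorAlgebra ℝ (A x →L[ℝ] ℝ)}
    (hu : u ∈ polySec I (F →L[ℝ] ℝ) (fun x => A x →L[ℝ] ℝ)) :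
    interiorSec P u ∈ polySec I (F →L[ℝ] ℝ) (fun x => A x →L[ℝ] ℝ) := by
  refine polySec_induction (p := fun P => interiorSec P u ∈
    polySec I (F →L[ℝ] ℝ) (fun x => A x →L[ℝ] ℝ)) ?_ ?_ ?_ ?_ ?_ hP
  · intro a b ha hb
    have : interiorSec (a + b) u = interiorSec a u + interiorSec b u := funext fun x => by
      simp [interiorSec]
    rw [this]
    exact add_mem ha hb
  · intro c a ha
    have : interiorSec (c • a) u = c • interiorSec a u := funext fun x => by
      simp [interiorSec]
    rw [this]
    exact Subalgebra.smul_mem _ ha c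
  · have : interiorSec (1 : (x : M) → ExteriorAlgebra ℝ (A x)) u = u := funext fun x => by
      simp [interiorSec]
    rwa [this]
  · intro f a _ ha
    have : interiorSec (fnSec I A f * a) u = fnSec I _ f * interiorSec a u := funext fun x => by
      simp only [interiorSec, fnSec, Pi.mul_apply, map_mul, AlgHom.commutes]
      rw [Module.End.mul_apply, Module.algebraMap_end_apply, Algebra.smul_def]
    rw [this]
    exact mul_mem (fnSec_mem f) ha
  · intro X a _ ha
    have : interiorSec (vecSec I F A X * a) u =
        interiorSec (vecSec I F A X) (interiorSec a u) := funext fun x => by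
      simp only [interiorSec, Pi.mul_apply, map_mul, Module.End.mul_apply]
    rw [this]
    exact interiorSec_poly_vec X ha

theorem interiorSec_mem {P : (x : M) → ExteriorAlgebra ℝ (A x)} (hP : P ∈ extSec I F A)
    {u : (x : M) → ExteriorAlgebra ℝ (A x →L[ℝ] ℝ)} (hu : u ∈ Form I F A) :
    interiorSec P u ∈ Form I F A := fun x => by
  obtain ⟨Q, hQ, h⟩ := hP x
  obtain ⟨η, hη, h'⟩ := hu x
  refine ⟨interiorSec Q η, interiorSec_poly hQ hη, ?_⟩
  filter_upwards [h, h'] with y hy hy'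
  rw [interiorSec, interiorSec, hy, hy']

/-- The interior product with a smooth multivector, as an operator on forms. -/
def interiorOp (P : (x : M) → ExteriorAlgebra ℝ (A x)) (hP : P ∈ extSec I F A) :
    Form I F A →ₗ[ℝ] Form I F A where
  toFun u := ⟨interiorSec P u.1, interiorSec_mem hP u.2⟩
  map_add' _ _ := Subtype.ext (funext fun x => map_add (intProd (evalAt x) (P x)) _ _)
  map_smul' _ _ := Subtype.ext (funext fun x => map_smul (intProd (evalAt x) (P x)) _ _)

/-- The endomorphism `α ↦ α ∘ T` of the dual space. -/
def transposeAt {x : M} (T : A x →L[ℝ] A x) : (A x →L[ℝ] ℝ) →ₗ[ℝ] (A x →L[ℝ] ℝ) where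
  toFun α := α.comp T
  map_add' _ _ := rfl
  map_smul' _ _ := rfl

/-- The derivation of degree zero of the forms that is induced by a `(1,1)`-tensor. -/
def derSec (N : EndTensor I F A) (u : (x : M) → ExteriorAlgebra ℝ (A x →L[ℝ] ℝ)) :
    (x : M) → ExteriorAlgebra ℝ (A x →L[ℝ] ℝ) :=
  fun x => extDer (transposeAt (N x)) (u x)

theorem derSec_poly (N : EndTensor I F A) {u : (x : M) → ExteriorAlgebra ℝ (A x →L[ℝ] ℝ)}
    (hu : u ∈ polySec I (F →L[ℝ] ℝ) (fun x => A x →L[ℝ] ℝ)) :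
    derSec N u ∈ polySec I (F →L[ℝ] ℝ) (fun x => A x →L[ℝ] ℝ) := by
  refine polySec_induction (p := fun u => derSec N u ∈
    polySec I (F →L[ℝ] ℝ) (fun x => A x →L[ℝ] ℝ)) ?_ ?_ ?_ ?_ ?_ hu
  · intro a b ha hb
    have : derSec N (a + b) = derSec N a + derSec N b := funext fun x => map_add _ _ _
    rw [this]
    exact add_mem ha hb
  · intro c a ha
    have : derSec N (c • a) = c • derSec N a := funext fun x =>
      map_smul (extDer (transposeAt (N x))) c (a x)
    rw [this]
    exact Subalgebra.smul_mem _ ha c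
  · have : derSec N 1 = 0 := funext fun x => by
      rw [derSec, Pi.one_apply, ← map_one (algebraMap ℝ _), extDer_algebraMap, Pi.zero_apply]
    rw [this]
    exact zero_mem _
  · intro f a _ ha
    have : derSec N (fnSec I _ f * a) = fnSec I _ f * derSec N a := funext fun x => by
      rw [derSec, Pi.mul_apply, extDer_mul, fnSec, extDer_algebraMap, zero_mul, zero_add]
      rfl
    rw [this]
    exact mul_mem (fnSec_mem f) ha
  · intro α a ha' ha
    have : derSec N (vecSec I _ _ α * a) =
        vecSec I _ _ (transpose N α) * a + vecSec I _ _ α * derSec N a := funext fun x => by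
      rw [derSec, Pi.mul_apply, extDer_mul, vecSec, extDer_ι]
      rfl
    rw [this]
    exact add_mem (mul_mem (vecSec_mem _) ha') (mul_mem (vecSec_mem α) ha)

theorem derSec_mem (N : EndTensor I F A) {u : (x : M) → ExteriorAlgebra ℝ (A x →L[ℝ] ℝ)}
    (hu : u ∈ Form I F A) : derSec N u ∈ Form I F A := fun x => by
  obtain ⟨η, hη, h⟩ := hu x
  refine ⟨derSec N η, derSec_poly N hη, ?_⟩
  filter_upwards [h] with y hy
  rw [derSec, derSec, hy]

/-- The derivation induced by a `(1,1)`-tensor, as an operator on forms. -/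
def derOp (N : EndTensor I F A) : Form I F A →ₗ[ℝ] Form I F A where
  toFun u := ⟨derSec N u.1, derSec_mem N u.2⟩
  map_add' _ _ := Subtype.ext (funext fun x => map_add (extDer (transposeAt (N x))) _ _)
  map_smul' _ _ := Subtype.ext (funext fun x => map_smul (extDer (transposeAt (N x))) _ _)

theorem one_mem_form : (1 : (x : M) → ExteriorAlgebra ℝ (A x →L[ℝ] ℝ)) ∈ Form I F A :=
  polySec_le (one_mem _)

theorem mul_fn_mem (f : C^∞⟮I, M; ℝ⟯) :
    (formAlg I F A).mul ⟨fnSec I _ f, polySec_le (fnSec_mem f)⟩ ∈ (formAlg I F A).ordLT 1 0 :=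
  (GCAlg.mem_ordLT_one _).2 ⟨_, fun _ => algebraMap_mem_extDeg _, rfl⟩

theorem mul_oneForm_mem (α : OneForm I F A) :
    (formAlg I F A).mul ⟨vecSec I _ _ α, polySec_le (vecSec_mem α)⟩ ∈ (formAlg I F A).ordLT 1 1 :=
  (GCAlg.mem_ordLT_one _).2 ⟨_, fun _ => ι_mem_extDeg _, rfl⟩

theorem interiorOp_vec_mem (X : Vec I F A) :
    interiorOp (vecSec I F A X) (polySec_le (vecSec_mem X)) ∈ (formAlg I F A).ordLT 2 (-1) := by
  have hs : interiorOp (vecSec I F A X) (polySec_le (vecSec_mem X)) ∈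
      (formAlg I F A).shift (-1) := by
    intro i a ha x
    change interiorSec _ _ x ∈ _
    rw [interiorSec_vecSec]
    exact contract_mem _ (ha x)
  refine (GCAlg.mem_ordLT_add_two _).2 ⟨hs, fun j a ha => (GCAlg.mem_ordLT_one _).2
    ⟨interiorOp (vecSec I F A X) (polySec_le (vecSec_mem X)) a, ?_, ?_⟩⟩
  · rw [add_comm]
    exact hs j a ha
  · refine LinearMap.ext fun b => Subtype.ext (funext fun x => ?_)
    change interiorSec _ a.1 x * b.1 x =
      interiorSec _ (a.1 * b.1) x - (-1 : ℝ) ^ (-1 * j) • (a.1 x * interiorSec _ b.1 x)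
    rw [interiorSec_vecSec, interiorSec_vecSec, interiorSec_vecSec, Pi.mul_apply,
      contract_mul _ (ha x), neg_one_mul, zpow_neg, ← inv_zpow, inv_neg_one, add_sub_cancel_right]

theorem derOp_mem (N : EndTensor I F A) : derOp N ∈ (formAlg I F A).ordLT 2 0 := by
  have hs : derOp N ∈ (formAlg I F A).shift 0 := by
    intro i a ha x
    rw [add_zero]
    exact extDer_mem _ (ha x)
  refine (GCAlg.mem_ordLT_add_two _).2 ⟨hs, fun j a ha => (GCAlg.mem_ordLT_one _).2
    ⟨derOp N a, ?_, ?_⟩⟩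
  · rw [add_comm]
    exact hs j a ha
  · refine LinearMap.ext fun b => Subtype.ext (funext fun x => ?_)
    change extDer _ (a.1 x) * b.1 x =
      extDer _ (a.1 x * b.1 x) - (-1 : ℝ) ^ (0 * j) • (a.1 x * extDer _ (b.1 x))
    rw [extDer_mul, zero_mul, zpow_zero, one_smul, add_sub_cancel_right]

theorem interiorOp_bivector_mem (π : Bivector I F A) :
    interiorOp π.val π.smooth ∈ (formAlg I F A).ordLT 3 (-2) := by
  have hs : interiorOp π.val π.smooth ∈ (formAlg I F A).shift (-2) :=
    fun i a ha x => intProd_two_mem _ (π.mem x) (ha x)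
  have hm : ∀ {i : ℤ} {a : Form I F A}, a ∈ (formAlg I F A).deg i →
      (formAlg I F A).mul a ∈ (formAlg I F A).shift i := fun ha j b hb => by
    rw [add_comm]
    exact (formAlg I F A).mul_mem ha hb
  refine (GCAlg.mem_ordLT_add_two _).2 ⟨hs, fun i a ha => (GCAlg.mem_ordLT_add_two _).2
    ⟨GCAlg.gcomm_mem_shift _ hs (hm ha), fun j b hb => (GCAlg.mem_ordLT_one _).2
      ⟨GCAlg.gcomm (-2 + i) j (GCAlg.gcomm (-2) i (interiorOp π.val π.smooth)
        ((formAlg I F A).mul a)) ((formAlg I F A).mul b) ⟨1, one_mem_form⟩, ?_, ?_⟩⟩⟩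
  · have h1 : (⟨1, one_mem_form⟩ : Form I F A) ∈ (formAlg I F A).deg 0 := fun x => by
      have := algebraMap_mem_extDeg (V := A x →L[ℝ] ℝ) 1
      rwa [map_one] at this
    have := GCAlg.gcomm_mem_shift _ (GCAlg.gcomm_mem_shift _ hs (hm ha)) (hm hb) 0 _ h1
    rwa [zero_add] at this
  · exact LinearMap.ext fun y => Subtype.ext (funext fun x =>
      (intProd_two_order (evalAt x) (π.mem x) (ha x) (hb x) (y.1 x)).symm)

variable (I F A)

/-- The algebra of functions on `T*[2]A[1]`: the functions on `A[1]` are the forms on `A`, and the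
functions on its cotangent bundle that are polynomial in the momenta are the principal symbols of
the differential operators on the algebra of forms. The bracket `⁅u, v⁆` is the canonical Poisson
bracket of the cotangent bundle, called the big bracket. -/
abbrev BigAlg : Type _ := (formAlg I F A).SymbAlg

/-- The elements of (unshifted) bidegree `(k, l)`; the shifted bidegree is `(k - 1, l - 1)`. -/
abbrev bideg (k : ℕ) (l : ℤ) : Submodule ℝ (BigAlg I F A) := (formAlg I F A).bideg k l

variable {I F A}

/-- A function on the base, as an element of bidegree `(0, 0)`. -/
def ofFn (f : C^∞⟮I, M; ℝ⟯) : BigAlg I F A := (formAlg I F A).symb 0 0 _ (mul_fn_mem f)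

/-- A `1`-form, as an element of bidegree `(0, 1)`. -/
def ofOneForm (α : OneForm I F A) : BigAlg I F A :=
  (formAlg I F A).symb 0 1 _ (mul_oneForm_mem α)

/-- A section of `A`, as an element of bidegree `(1, 0)`. -/
def ofVec (X : Vec I F A) : BigAlg I F A :=
  (formAlg I F A).symb 1 (-1) _ (interiorOp_vec_mem X)

/-- A `(1,1)`-tensor, as an element of bidegree `(1, 1)`. -/
def ofTensor (N : EndTensor I F A) : BigAlg I F A :=
  (formAlg I F A).symb 1 0 _ (derOp_mem N)

/-- A bivector, as an element of bidegree `(2, 0)`. -/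
def ofBivector (π : Bivector I F A) : BigAlg I F A :=
  (formAlg I F A).symb 2 (-2) _ (interiorOp_bivector_mem π)

/-- A Lie algebroid structure on `A`: an element `μ` of shifted bidegree `(0, 1)` with
`{μ, μ} = 0`. -/
def IsLieAlgebroid (μ : BigAlg I F A) : Prop :=
  μ ∈ bideg I F A 1 2 ∧ ⁅μ, μ⁆ = 0

/-- A Lie bialgebroid structure on `(A, A*)`: elements `μ` and `γ` of shifted bidegrees `(0, 1)`
and `(1, 0)` with `{μ + γ, μ + γ} = 0`. -/
def IsLieBialgebroid (μ γ : BigAlg I F A) : Prop :=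
  μ ∈ bideg I F A 1 2 ∧ γ ∈ bideg I F A 2 1 ∧ ⁅μ + γ, μ + γ⁆ = 0

/-- The bracket `[X, Y]_μ = {{X, μ}, Y}`. -/
def derivedBracket (μ X Y : BigAlg I F A) : BigAlg I F A := ⁅⁅X, μ⁆, Y⁆

/-- `π` is a Poisson bivector: `[π, π]_μ = 0`. -/
def IsPoisson (μ : BigAlg I F A) (π : Bivector I F A) : Prop :=
  derivedBracket μ (ofBivector π) (ofBivector π) = 0

/-- The image `N X = {X, N}` of a section of `A` under a `(1,1)`-tensor. -/
def applyTensor (N : EndTensor I F A) (X : BigAlg I F A) : BigAlg I F A := ⁅X, ofTensor N⁆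

/-- The Nijenhuis torsion
`(T_μ N)(X, Y) = [NX, NY]_μ - N ([NX, Y]_μ + [X, NY]_μ) + N² [X, Y]_μ`. -/
def torsion (μ : BigAlg I F A) (N : EndTensor I F A) (X Y : Vec I F A) : BigAlg I F A :=
  derivedBracket μ (applyTensor N (ofVec X)) (applyTensor N (ofVec Y)) -
    applyTensor N (derivedBracket μ (applyTensor N (ofVec X)) (ofVec Y) +
      derivedBracket μ (ofVec X) (applyTensor N (ofVec Y))) +
    applyTensor N (applyTensor N (derivedBracket μ (ofVec X) (ofVec Y)))

/-- `N` is a Nijenhuis tensor: its torsion vanishes. -/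
def IsNijenhuis (μ : BigAlg I F A) (N : EndTensor I F A) : Prop :=
  ∀ X Y : Vec I F A, torsion μ N X Y = 0

/-- The deformed structure `μ_N = {N, μ}`. -/
def deformed (μ : BigAlg I F A) (N : EndTensor I F A) : BigAlg I F A := ⁅ofTensor N, μ⁆

/-- The element `γ_π = {π, μ}`. -/
def cobracket (μ : BigAlg I F A) (π : Bivector I F A) : BigAlg I F A := ⁅ofBivector π, μ⁆

/-- `C_μ(π, N) = {π, {N, μ}} + {N, {π, μ}}`. -/
def concomitant (μ : BigAlg I F A) (π : Bivector I F A) (N : EndTensor I F A) : BigAlg I F A :=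
  ⁅ofBivector π, ⁅ofTensor N, μ⁆⁆ + ⁅ofTensor N, ⁅ofBivector π, μ⁆⁆

/-- The map `π^♯ : A* → A`, `π^♯ α = i_α π`. -/
def sharp (π : Bivector I F A) (x : M) (α : A x →L[ℝ] ℝ) : A x :=
  ExteriorAlgebra.ιInv (CliffordAlgebra.contractLeft (α : Module.Dual ℝ (A x)) (π.val x))

/-- `π` and `N` are compatible: `N ∘ π^♯ = π^♯ ∘ N*` and `C_μ(π, N) = 0`. -/
def IsCompatible (μ : BigAlg I F A) (π : Bivector I F A) (N : EndTensor I F A) : Prop :=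
  (∀ (x : M) (α : A x →L[ℝ] ℝ), N x (sharp π x α) = sharp π x (α.comp (N x))) ∧
    concomitant μ π N = 0

/-- `(π, N)` is a `PN`-structure: a Poisson bivector and a Nijenhuis tensor that are
compatible. -/
def IsPN (μ : BigAlg I F A) (π : Bivector I F A) (N : EndTensor I F A) : Prop :=
  IsPoisson μ π ∧ IsNijenhuis μ N ∧ IsCompatible μ π N

/-- The `1`-form `β` is `d_μ`-exact: `β = d_μ f = {μ, f}` for a smooth function `f`. -/
def IsExactOneForm (μ : BigAlg I F A) (β : OneForm I F A) : Prop :=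
  ∃ f : C^∞⟮I, M; ℝ⟯, ofOneForm β = ⁅μ, ofFn f⁆

/-- The `d_μ`-exact `1`-forms generate the module of `1`-forms locally: each point has a
neighbourhood `U` such that each `1`-form agrees on `U` with a linear combination of `d_μ`-exact
`1`-forms with smooth functions as coefficients. -/
def ExactFormsGenerate (μ : BigAlg I F A) : Prop :=
  ∀ x : M, ∃ U ∈ 𝓝 x, ∀ α : OneForm I F A,
    ∃ (n : ℕ) (g : Fin n → C^∞⟮I, M; ℝ⟯) (β : Fin n → OneForm I F A),
      (∀ i, IsExactOneForm μ (β i)) ∧ ∀ y ∈ U, α y = ∑ i, g i y • β i y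

end Geometry

end BigBracket

end

open BigBracket

noncomputable section

open scoped Manifold ContDiff Topology DirectSum

namespace BigBracket

/-! ### Calculus of principal symbols: grading, skew-symmetry, Jacobi and Leibniz rules. -/

namespace GCAlg

variable {Ω : Type*} [AddCommGroup Ω] [Module ℝ Ω] (G : GCAlg Ω)

/-! Write a symbol of bidegree (k, l) as one of order k and degree s = l - k; signs in the big
bracket depend only on the degrees. Here μ, N, π, γ = {π, μ} and C = C_μ(π, N) have degrees 1, 0,
-2, -1, -1. Skew-symmetry and the Jacobi identity are inherited from graded commutators of
operators. Everything then reduces to computations in a graded Lie algebra, together with the fact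
that a symbol of positive order vanishes once its brackets with functions and 1-forms vanish
(`eq_zero_of_bracket_eq_zero`). That fact rests on the locality of differential operators: near a
point every form is a polynomial in functions and 1-forms, and the commutator with an operator obeys
the Leibniz rule.

Part (i). Expanding, {μ_N + γ, μ_N + γ} = {μ_N, μ_N} + 2{μ_N, γ} + {γ, γ}. The last term is zero by
Jacobi because {γ, π} = [π, π]_μ = 0 and {μ, γ} = 0. For the first, twice the torsion of N is the
derived bracket of {{μ, N}, N} + {μ, N²} (`two_smul_torsion`), and an element of shifted bidegree
(0, 1) is determined by its derived bracket (`eq_zero_of_derivedBracket_eq_zero`). So N Nijenhuis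
gives {N, {N, μ}} = {N², μ}, and applying {μ, ·} gives {μ_N, μ_N} = 0. Finally {μ, C} = -2{μ_N, γ}
(`bracket_concomitant`), so the bialgebroid condition is exactly {μ, C} = 0.

Part (ii). For a 1-form α put T(α) = {π, {N, α}} + {N, {π, α}}. It is the section (N π^♯ - π^♯ N*) α
of A, and its pairing with β is symmetric in α and β because π is skew. Since π and N have zero
bracket with functions, {C, f} = T(d_μ f). If {μ, C} = 0, then {{C, f}, d_μ g} is skew in f and g by
Jacobi. A pairing both symmetric and skew is zero, so T(d_μ f) pairs to zero with all exact forms.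
As these generate, T(d_μ f) = 0. This yields N π^♯ = π^♯ N* on exact forms, hence everywhere, and
{C, f} = 0. Then {C, d_μ f} = -{μ, {C, f}} = 0 as well, so C = 0. -/

theorem bracket_add (u v w : G.SymbAlg) : ⁅u, v + w⁆ = ⁅u, v⁆ + ⁅u, w⁆ :=
  map_add (G.bracket u) v w

theorem add_bracket (u v w : G.SymbAlg) : ⁅u + v, w⁆ = ⁅u, w⁆ + ⁅v, w⁆ :=
  LinearMap.congr_fun (map_add G.bracket u v) w

theorem sub_bracket (u v w : G.SymbAlg) : ⁅u - v, w⁆ = ⁅u, w⁆ - ⁅v, w⁆ :=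
  LinearMap.congr_fun (map_sub G.bracket u v) w

theorem bracket_neg (u v : G.SymbAlg) : ⁅u, -v⁆ = -⁅u, v⁆ := map_neg (G.bracket u) v

theorem neg_bracket (u v : G.SymbAlg) : ⁅-u, v⁆ = -⁅u, v⁆ :=
  LinearMap.congr_fun (map_neg G.bracket u) v

theorem bracket_zero (u : G.SymbAlg) : ⁅u, (0 : G.SymbAlg)⁆ = 0 := map_zero (G.bracket u)

theorem zero_bracket (u : G.SymbAlg) : ⁅(0 : G.SymbAlg), u⁆ = 0 :=
  LinearMap.congr_fun (map_zero G.bracket) u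

/-- The principal symbols of order `k` and degree `s`, inside the algebra of all symbols. -/
def hom (k : ℕ) (s : ℤ) : Submodule ℝ G.SymbAlg := LinearMap.range (G.incl k s)

variable {G}

theorem symb_mem_hom {k : ℕ} {s : ℤ} {P : Ω →ₗ[ℝ] Ω} (hP : P ∈ G.ordLT (k + 1) s) :
    G.symb k s P hP ∈ G.hom k s := ⟨_, rfl⟩

theorem exists_symb {k : ℕ} {s : ℤ} {u : G.SymbAlg} (hu : u ∈ G.hom k s) :
    ∃ (P : Ω →ₗ[ℝ] Ω) (hP : P ∈ G.ordLT (k + 1) s), u = G.symb k s P hP := by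
  obtain ⟨x, rfl⟩ := hu
  obtain ⟨⟨P, hP⟩, rfl⟩ := Submodule.mkQ_surjective _ x
  exact ⟨P, hP, rfl⟩

theorem incl_injective (k : ℕ) (s : ℤ) : Function.Injective (G.incl k s) :=
  DirectSum.of_injective (β := fun p : ℕ × ℤ => G.Symb p.1 p.2) (k, s)

theorem symb_eq_zero {k : ℕ} {s : ℤ} {P : Ω →ₗ[ℝ] Ω} (hP : P ∈ G.ordLT (k + 1) s) :
    G.symb k s P hP = 0 ↔ P ∈ G.ordLT k s := by
  rw [symb, ← map_zero (G.incl k s), (incl_injective k s).eq_iff, toSymb_eq_zero]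

/-- Orders and degrees of brackets computed in two ways often agree only propositionally; this
transports a symbol along such equalities. -/
theorem symb_congr {k l : ℕ} {s t : ℤ} {P Q : Ω →ₗ[ℝ] Ω} (hP : P ∈ G.ordLT (k + 1) s)
    (hk : k = l) (hs : s = t) (h : P = Q) :
    G.symb k s P hP = G.symb l t Q (hk ▸ hs ▸ h ▸ hP) := by
  subst hk hs h
  rfl

theorem symb_add {k : ℕ} {s : ℤ} {P Q : Ω →ₗ[ℝ] Ω} (hP : P ∈ G.ordLT (k + 1) s)
    (hQ : Q ∈ G.ordLT (k + 1) s) :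
    G.symb k s (P + Q) (add_mem hP hQ) = G.symb k s P hP + G.symb k s Q hQ := by
  rw [symb, symb, symb, ← map_add, ← map_add]
  rfl

theorem symb_smul {k : ℕ} {s : ℤ} (c : ℝ) {P : Ω →ₗ[ℝ] Ω} (hP : P ∈ G.ordLT (k + 1) s) :
    G.symb k s (c • P) (Submodule.smul_mem _ c hP) = c • G.symb k s P hP := by
  rw [symb, symb, ← map_smul, ← map_smul]
  rfl

theorem bracket_mem_hom {k l : ℕ} {s t : ℤ} {u v : G.SymbAlg} (hu : u ∈ G.hom k s)
    (hv : v ∈ G.hom l t) : ⁅u, v⁆ ∈ G.hom (k + l - 1) (s + t) := by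
  obtain ⟨P, hP, rfl⟩ := exists_symb hu
  obtain ⟨Q, hQ, rfl⟩ := exists_symb hv
  rw [bracket_symb]
  exact symb_mem_hom _

theorem bracket_mem_hom_of_eq {k l m : ℕ} {s t r : ℤ} {u v : G.SymbAlg} (hu : u ∈ G.hom k s)
    (hv : v ∈ G.hom l t) (hm : k + l - 1 = m := by norm_num)
    (hr : s + t = r := by norm_num) : ⁅u, v⁆ ∈ G.hom m r :=
  hm ▸ hr ▸ bracket_mem_hom hu hv

theorem gcomm_eq_zero_of_ordLT_one {s t : ℤ} {P Q : Ω →ₗ[ℝ] Ω} (hP : P ∈ G.ordLT 1 s)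
    (hQ : Q ∈ G.ordLT 1 t) : gcomm s t P Q = 0 := by
  have := G.gcomm_mem _ _ _ le_rfl _ _ _ _ hP hQ
  rwa [ordLT_zero, Submodule.mem_bot] at this

theorem bracket_eq_zero_of_hom_zero {s t : ℤ} {u v : G.SymbAlg} (hu : u ∈ G.hom 0 s)
    (hv : v ∈ G.hom 0 t) : ⁅u, v⁆ = 0 := by
  obtain ⟨P, hP, rfl⟩ := exists_symb hu
  obtain ⟨Q, hQ, rfl⟩ := exists_symb hv
  rw [bracket_symb, symb_eq_zero, gcomm_eq_zero_of_ordLT_one hP hQ]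
  exact Submodule.zero_mem _

theorem bracket_symb_of_eq {k l m : ℕ} {s t : ℤ} {P Q : Ω →ₗ[ℝ] Ω} (hP : P ∈ G.ordLT (k + 1) s)
    (hQ : Q ∈ G.ordLT (l + 1) t) (hm : k + l - 1 = m) (h : gcomm s t P Q ∈ G.ordLT (m + 1) (s + t)) :
    ⁅G.symb k s P hP, G.symb l t Q hQ⁆ = G.symb m (s + t) (gcomm s t P Q) h := by
  subst hm
  exact G.bracket_symb k l s t P Q hP hQ

theorem bracket_bracket_mem {k l m : ℕ} {s t r : ℤ} {P Q R : Ω →ₗ[ℝ] Ω}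
    (hP : P ∈ G.ordLT (k + 1) s) (hQ : Q ∈ G.ordLT (l + 1) t) (hR : R ∈ G.ordLT (m + 1) r) :
    gcomm s (t + r) P (gcomm t r Q R) ∈ G.ordLT (k + l + m - 2 + 1) (s + (t + r)) :=
  G.ordLT_mono (by omega) _ (G.gcomm_mem _ _ _ le_rfl _ _ _ _ hP
    (G.gcomm_mem _ _ _ le_rfl _ _ _ _ hQ hR))

theorem bracket_bracket_symb {k l m : ℕ} {s t r : ℤ} {P Q R : Ω →ₗ[ℝ] Ω}
    (hP : P ∈ G.ordLT (k + 1) s) (hQ : Q ∈ G.ordLT (l + 1) t) (hR : R ∈ G.ordLT (m + 1) r) :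
    ⁅G.symb k s P hP, ⁅G.symb l t Q hQ, G.symb m r R hR⁆⁆ =
      G.symb (k + l + m - 2) (s + (t + r)) (gcomm s (t + r) P (gcomm t r Q R))
        (bracket_bracket_mem hP hQ hR) := by
  -- Truncated subtraction: for l = m = 0 the inner bracket is placed in order 0 instead of -1, so
  -- the indices do not match. In that case both sides vanish, since multiplications commute.
  by_cases h : l + m = 0
  · obtain ⟨rfl, rfl⟩ : l = 0 ∧ m = 0 := by omega
    rw [bracket_eq_zero_of_hom_zero (symb_mem_hom hQ) (symb_mem_hom hR), bracket_zero, eq_comm,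
      symb_eq_zero, gcomm_eq_zero_of_ordLT_one hQ hR, map_zero]
    exact Submodule.zero_mem _
  · rw [bracket_symb]
    exact bracket_symb_of_eq _ _ (by omega) _

/-- The bracket of symbols is graded skew-symmetric. -/
theorem bracket_skew {k l : ℕ} {s t : ℤ} {u v : G.SymbAlg} (hu : u ∈ G.hom k s)
    (hv : v ∈ G.hom l t) : ⁅u, v⁆ = -((-1 : ℝ) ^ (s * t) • ⁅v, u⁆) := by
  obtain ⟨P, hP, rfl⟩ := exists_symb hu
  obtain ⟨Q, hQ, rfl⟩ := exists_symb hv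
  rw [bracket_symb, bracket_symb, ← neg_smul, ← symb_smul]
  refine symb_congr _ (by omega) (add_comm _ _) ?_
  rw [gcomm_skew, neg_smul]

/-- The graded Jacobi identity: the bracket with `u` is a derivation of the bracket. -/
theorem bracket_jacobi {k l m : ℕ} {s t r : ℤ} {u v w : G.SymbAlg} (hu : u ∈ G.hom k s)
    (hv : v ∈ G.hom l t) (hw : w ∈ G.hom m r) :
    ⁅u, ⁅v, w⁆⁆ = ⁅⁅u, v⁆, w⁆ + (-1 : ℝ) ^ (s * t) • ⁅v, ⁅u, w⁆⁆ := by
  -- All three terms become right-nested, so that each is the symbol of an iterated commutator and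
  -- the identity follows from `gcomm_jacobi`.
  rw [bracket_skew (bracket_mem_hom hu hv) hw]
  obtain ⟨P, hP, rfl⟩ := exists_symb hu
  obtain ⟨Q, hQ, rfl⟩ := exists_symb hv
  obtain ⟨R, hR, rfl⟩ := exists_symb hw
  rw [bracket_bracket_symb, bracket_bracket_symb, bracket_bracket_symb, ← neg_smul, ← symb_smul,
    ← symb_smul]
  have h1 := bracket_bracket_mem hR hP hQ
  have h2 := bracket_bracket_mem hQ hP hR
  rw [show r + (s + t) = s + (t + r) by ring, show m + k + l = k + l + m by ring] at h1
  rw [show t + (s + r) = s + (t + r) by ring, show l + k + m = k + l + m by ring] at h2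
  rw [symb_congr (k := m + k + l - 2) (l := k + l + m - 2) (t := s + (t + r)) _
    (by congr 1; ring) (by ring) rfl, symb_congr (k := l + k + m - 2) (l := k + l + m - 2)
    (t := s + (t + r)) _ (by congr 1; ring) (by ring) rfl, ← symb_add]
  refine symb_congr _ rfl rfl ?_
  rw [gcomm_skew r (s + t) R, gcomm_skew t (s + r) Q, gcomm_jacobi, mul_comm r (s + t),
    smul_neg, smul_smul, neg_mul, neg_one_zpow_mul_self,
    neg_smul, one_smul, neg_neg, mul_add t s r,
    zpow_add₀ (by norm_num), smul_neg, smul_smul, mul_comm t s, ← _root_.mul_assoc,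
    neg_one_zpow_mul_self, one_mul, add_neg_cancel_right]

theorem bracket_skew_even {k l : ℕ} {s t : ℤ} {u v : G.SymbAlg} (hu : u ∈ G.hom k s)
    (hv : v ∈ G.hom l t) (h : Even (s * t)) : ⁅u, v⁆ = -⁅v, u⁆ := by
  rw [bracket_skew hu hv, h.neg_one_zpow, one_smul]

theorem bracket_comm_odd {k l : ℕ} {s t : ℤ} {u v : G.SymbAlg} (hu : u ∈ G.hom k s)
    (hv : v ∈ G.hom l t) (h : Odd (s * t)) : ⁅u, v⁆ = ⁅v, u⁆ := by
  rw [bracket_skew hu hv, h.neg_one_zpow, neg_one_smul, neg_neg]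

theorem bracket_jacobi_even {k l m : ℕ} {s t r : ℤ} {u v w : G.SymbAlg} (hu : u ∈ G.hom k s)
    (hv : v ∈ G.hom l t) (hw : w ∈ G.hom m r) (h : Even (s * t)) :
    ⁅u, ⁅v, w⁆⁆ = ⁅⁅u, v⁆, w⁆ + ⁅v, ⁅u, w⁆⁆ := by
  rw [bracket_jacobi hu hv hw, h.neg_one_zpow, one_smul]

theorem bracket_jacobi_odd {k l m : ℕ} {s t r : ℤ} {u v w : G.SymbAlg} (hu : u ∈ G.hom k s)
    (hv : v ∈ G.hom l t) (hw : w ∈ G.hom m r) (h : Odd (s * t)) :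
    ⁅u, ⁅v, w⁆⁆ = ⁅⁅u, v⁆, w⁆ - ⁅v, ⁅u, w⁆⁆ := by
  rw [bracket_jacobi hu hv hw, h.neg_one_zpow, neg_one_smul, sub_eq_add_neg]

theorem bracket_bracket_self_eq_zero {k l : ℕ} {s t : ℤ} {u v : G.SymbAlg} (hu : u ∈ G.hom k s)
    (hs : Odd s) (h : ⁅u, u⁆ = 0) (hv : v ∈ G.hom l t) : ⁅u, ⁅u, v⁆⁆ = 0 := by
  have := bracket_jacobi_odd hu hu hv (hs.mul hs)
  rw [h, zero_bracket, zero_sub] at this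
  have h2 : (2 : ℝ) • ⁅u, ⁅u, v⁆⁆ = 0 := by
    rw [two_smul, ← eq_neg_iff_add_eq_zero]
    exact this
  exact (smul_eq_zero.1 h2).resolve_left two_ne_zero

theorem gcomm_mul_sum_mem {ι : Type*} (t : Finset ι) (s j : ℤ) (P : Ω →ₗ[ℝ] Ω) {c : ι → Ω}
    {S : Submodule ℝ (Ω →ₗ[ℝ] Ω)} (h : ∀ i ∈ t, gcomm s j P (G.mul (c i)) ∈ S) :
    gcomm s j P (G.mul (∑ i ∈ t, c i)) ∈ S := by
  rw [map_sum, map_sum]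
  exact sum_mem h

theorem gcomm_comp (s i j : ℤ) (P Q R : Ω →ₗ[ℝ] Ω) :
    gcomm s (i + j) P (Q ∘ₗ R) =
      gcomm s i P Q ∘ₗ R + (-1 : ℝ) ^ (s * i) • (Q ∘ₗ gcomm s j P R) := by
  rw [gcomm_apply, gcomm_apply, gcomm_apply, mul_add, zpow_add₀ (by norm_num), LinearMap.sub_comp,
    LinearMap.comp_sub, LinearMap.smul_comp, LinearMap.comp_smul, smul_sub, smul_smul,
    LinearMap.comp_assoc, LinearMap.comp_assoc, LinearMap.comp_assoc]
  abel

theorem mul_mul (a b : Ω) : G.mul (G.mul a b) = G.mul a ∘ₗ G.mul b :=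
  LinearMap.ext fun c => G.mul_assoc a b c

/-- Since b graded-commutes with every a, the commutator of b ∘ Q with a is b ∘ [Q, a]; induct on
the order. -/
theorem mul_comp_mem {k : ℕ} : ∀ {s j : ℤ} {Q : Ω →ₗ[ℝ] Ω} {b : Ω}, Q ∈ G.ordLT k s →
    b ∈ G.deg j → G.mul b ∘ₗ Q ∈ G.ordLT k (j + s) := by
  induction k with
  | zero =>
    intro s j Q b hQ _
    rw [ordLT_zero, Submodule.mem_bot] at hQ
    rw [hQ, LinearMap.comp_zero]
    exact Submodule.zero_mem _
  | succ k ih =>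
    intro s j Q b hQ hb
    match k with
    | 0 =>
      obtain ⟨q, hq, rfl⟩ := G.mem_ordLT_one.1 hQ
      exact G.mem_ordLT_one.2 ⟨_, G.mul_mem hb hq, mul_mul _ _⟩
    | k + 1 =>
      obtain ⟨h1, h2⟩ := G.mem_ordLT_add_two.1 hQ
      refine G.mem_ordLT_add_two.2 ⟨fun i a ha => ?_, fun i a ha => ?_⟩
      · rw [show i + (j + s) = j + (i + s) by ring]
        exact G.mul_mem hb (h1 i a ha)
      · have h : gcomm (j + s) i (G.mul b ∘ₗ Q) (G.mul a) = G.mul b ∘ₗ gcomm s i Q (G.mul a) := by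
          rw [gcomm_apply, gcomm_apply, ← LinearMap.comp_assoc, ← mul_mul, G.comm ha hb, map_smul,
            LinearMap.smul_comp, smul_smul, add_mul, zpow_add₀ (by norm_num), mul_comm i j,
            mul_right_comm, neg_one_zpow_mul_self, one_mul, mul_mul, LinearMap.comp_sub,
            LinearMap.comp_smul, LinearMap.comp_assoc, LinearMap.comp_assoc]
        rw [h, add_assoc]
        exact ih (h2 i a ha) hb

/-- Q ∘ b = [Q, b] ± b ∘ Q, and the commutator has no larger order than Q. -/
theorem comp_mul_mem {k : ℕ} {s j : ℤ} {Q : Ω →ₗ[ℝ] Ω} {b : Ω} (hQ : Q ∈ G.ordLT k s)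
    (hb : b ∈ G.deg j) : Q ∘ₗ G.mul b ∈ G.ordLT k (s + j) := by
  have h := G.gcomm_mem _ _ _ le_rfl _ _ _ _ hQ (G.mem_ordLT_one.2 ⟨b, hb, rfl⟩)
  have h' := Submodule.smul_mem _ ((-1 : ℝ) ^ (s * j)) (mul_comp_mem hQ hb)
  rw [add_comm j s] at h'
  have := add_mem (G.ordLT_mono (by omega : k + 1 - 2 ≤ k) _ h) h'
  rwa [gcomm_apply, sub_add_cancel] at this

/-- The commutator with P is a graded derivation, so the condition on a that [P, a] has order below
k is stable under products. Hence it need only be tested on generators. -/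
theorem gcomm_mul_mul_mem {k : ℕ} {s i j : ℤ} {P : Ω →ₗ[ℝ] Ω} {a b : Ω} (ha : a ∈ G.deg i)
    (hb : b ∈ G.deg j) (h : gcomm s i P (G.mul a) ∈ G.ordLT k (s + i))
    (h' : gcomm s j P (G.mul b) ∈ G.ordLT k (s + j)) :
    gcomm s (i + j) P (G.mul (G.mul a b)) ∈ G.ordLT k (s + (i + j)) := by
  rw [mul_mul, gcomm_comp]
  refine add_mem ?_ (Submodule.smul_mem _ _ ?_)
  · rw [← add_assoc]
    exact comp_mul_mem h hb
  · rw [add_left_comm]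
    exact mul_comp_mem h' ha

/-- If `i` is of degree `-1` and commutes with `f` of degree `0`, then the commutator of the Lie
derivative `[i, D]` with `f` is `[i, [D, f]]`. -/
theorem gcomm_gcomm_deg_zero {i D f b c : Ω →ₗ[ℝ] Ω} (h : gcomm 1 0 D f = b)
    (h0 : gcomm (-1) 0 i f = 0) (h1 : gcomm (-1) 1 i b = c) :
    gcomm (-1 + 1) 0 (gcomm (-1) 1 i D) f = c := by
  rw [gcomm_jacobi, h, h0, map_zero, LinearMap.zero_apply, smul_zero, add_zero]
  exact h1

/-- If the Lie derivative `[i, D]` commutes with `i'`, then the iterated commutator `[i', [i, [D, a]]]`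
with an operator `a` of degree one vanishes, provided that `[i, a]` commutes with `D` and that
`[i', a]` commutes with `[i, D]`. -/
theorem gcomm_gcomm_deg_one {i i' D a g g' h b c : Ω →ₗ[ℝ] Ω}
    (hE : gcomm (-1 + 1) (-1) (gcomm (-1) 1 i D) i' = 0) (hDa : gcomm 1 1 D a = h)
    (hi : gcomm (-1) 1 i a = g) (hi' : gcomm (-1) 1 i' a = g') (hDg : gcomm 1 0 D g = 0)
    (hLg : gcomm (-1 + 1) 0 (gcomm (-1) 1 i D) g' = 0) (hb : gcomm (-1) (1 + 1) i h = b)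
    (hc : gcomm (-1) 1 i' b = c) : c = 0 := by
  have h1 := gcomm_jacobi (-1) 1 1 i D a
  rw [hDa, hb, hi, gcomm_skew (-1 + 1) 1 g D] at h1
  change _ = _ + (-1 : ℝ) ^ (1 * 1 : ℤ) • -((-1 : ℝ) ^ ((-1 + 1) * 1 : ℤ) • gcomm 1 0 D g) at h1
  rw [hDg, smul_zero, neg_zero, smul_zero, add_zero] at h1
  -- With L = [i, D], the previous identity reads [L, a] = b. Jacobi for L, i', a now gives 0 = [L,
  -- [i', a]] ± [b, i'], whose first term vanishes by hypothesis.
  have h2 := gcomm_jacobi (-1 + 1) (-1) 1 (gcomm (-1) 1 i D) i' a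
  rw [hE, map_zero, LinearMap.zero_apply, h1, hi'] at h2
  change 0 = gcomm (-1 + 1) 0 (gcomm (-1) 1 i D) g' +
    (-1 : ℝ) ^ (-1 * 1 : ℤ) • gcomm 1 (-1) b i' at h2
  rw [hLg, zero_add, gcomm_skew, hc] at h2
  simpa using h2.symm

/-- Leibniz with L = [i, D]: [L, f i'] = [L, f] i' + f [L, i'], where two of the three terms vanish.
-/
theorem gcomm_mul_comp_eq_zero {i D f i' i'' : Ω →ₗ[ℝ] Ω} (hi : i'' = f ∘ₗ i')
    (h : gcomm (-1 + 1) (-1) (gcomm (-1) 1 i D) i' = 0)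
    (h' : gcomm (-1 + 1) (-1) (gcomm (-1) 1 i D) i'' = 0) :
    gcomm (-1 + 1) 0 (gcomm (-1) 1 i D) f ∘ₗ i' = 0 := by
  have h1 := gcomm_comp (-1 + 1) 0 (-1) (gcomm (-1) 1 i D) f i'
  rw [zero_add, ← hi, h, h', LinearMap.comp_zero, smul_zero, add_zero] at h1
  exact h1.symm

end GCAlg
end BigBracket

namespace BigBracket

/-! ### Homogeneous components in the exterior algebra. -/

section ExteriorProjection

variable {V : Type*} [AddCommGroup V] [Module ℝ V]

/-- The homogeneous component of degree `n` of an element of the exterior algebra. -/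
def extProj (n : ℕ) : ExteriorAlgebra ℝ V →ₗ[ℝ] ExteriorAlgebra ℝ V :=
  GradedAlgebra.proj (fun i : ℕ => ⋀[ℝ]^i V) n

theorem extProj_of_mem {n : ℕ} {a : ExteriorAlgebra ℝ V} (ha : a ∈ ⋀[ℝ]^n V) :
    extProj n a = a :=
  DirectSum.decompose_of_mem_same (fun i : ℕ => ⋀[ℝ]^i V) ha

theorem extProj_one_of_ne {n : ℕ} (hn : n ≠ 0) : extProj n (1 : ExteriorAlgebra ℝ V) = 0 :=
  DirectSum.decompose_of_mem_ne (fun i : ℕ => ⋀[ℝ]^i V)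
    (SetLike.GradedOne.one_mem (A := fun i : ℕ => ⋀[ℝ]^i V)) hn.symm

theorem extProj_zero_ι_mul (v : V) (a : ExteriorAlgebra ℝ V) :
    extProj 0 (ExteriorAlgebra.ι ℝ v * a) = 0 :=
  DirectSum.coe_decompose_mul_of_left_mem_of_not_le (fun i : ℕ => ⋀[ℝ]^i V)
    (ι_mem_extDeg v : _ ∈ ⋀[ℝ]^1 V) (by norm_num)

theorem extProj_succ_ι_mul (n : ℕ) (v : V) (a : ExteriorAlgebra ℝ V) :
    extProj (n + 1) (ExteriorAlgebra.ι ℝ v * a) = ExteriorAlgebra.ι ℝ v * extProj n a :=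
  DirectSum.coe_decompose_mul_of_left_mem_of_le (fun i : ℕ => ⋀[ℝ]^i V)
    (ι_mem_extDeg v : _ ∈ ⋀[ℝ]^1 V) (Nat.le_add_left 1 n)

end ExteriorProjection

/-! ### Locality of differential operators and testing of the order on generators. -/

section LocalOperators

variable {E H M : Type*} [NormedAddCommGroup E] [NormedSpace ℝ E] [TopologicalSpace H]
  {I : ModelWithCorners ℝ E H} [TopologicalSpace M] [ChartedSpace H M]

theorem exists_smooth_eq_zero_eq_one [FiniteDimensional ℝ E] [IsManifold I ∞ M] [T2Space M]
    {x : M} {U : Set M} (hU : U ∈ 𝓝 x) :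
    ∃ f : C^∞⟮I, M; ℝ⟯, f x = 0 ∧ ∀ y ∉ U, f y = 1 := by
  obtain ⟨b, -, hb⟩ := (SmoothBumpFunction.nhds_basis_support (I := I) hU).mem_iff.1 hU
  refine ⟨⟨fun y => 1 - b y, contMDiff_const.sub b.contMDiff⟩, ?_, fun y hy => ?_⟩
  · change 1 - b x = 0
    rw [b.eq_one, sub_self]
  · change 1 - b y = 1
    rw [Function.notMem_support.1 fun h => hy (hb h), sub_zero]

variable {G : Type*} [NormedAddCommGroup G] [NormedSpace ℝ G] {B : M → Type*}
  [∀ x, AddCommGroup (B x)] [∀ x, Module ℝ (B x)] [TopologicalSpace (Bundle.TotalSpace G B)]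
  [∀ x, TopologicalSpace (B x)] [FiberBundle G B]

/-- Every vector of a smooth vector bundle is the value of a global smooth section. -/
theorem exists_section_apply_eq [FiniteDimensional ℝ E] [IsManifold I ∞ M] [T2Space M]
    [VectorBundle ℝ G B] [ContMDiffVectorBundle ∞ G B I] {x : M} (v : B x) :
    ∃ X : Cₛ^∞⟮I; G, B⟯, X x = v := by
  obtain ⟨s, hs, h⟩ := FiberBundle.exists_contMDiffOn_extend (k := ∞) I G v
  obtain ⟨b, -, hb⟩ := (SmoothBumpFunction.nhds_basis_tsupport (I := I) x).mem_iff.1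
    (interior_mem_nhds.2 hs)
  refine ⟨⟨_, ContMDiffOn.smul_section_of_tsupport (b.contMDiff.contMDiffOn) isOpen_interior hb
    (h.mono interior_subset)⟩, ?_⟩
  change b x • FiberBundle.extend G v x = v
  rw [b.eq_one, one_smul, FiberBundle.extend_apply_self]

/-- A function as an element of the algebra of sections of the exterior bundle. -/
def fnExt (f : C^∞⟮I, M; ℝ⟯) : extSec I G B := ⟨fnSec I B f, polySec_le (fnSec_mem f)⟩

/-- A section as an element of the algebra of sections of the exterior bundle. -/
def vecExt (X : Cₛ^∞⟮I; G, B⟯) : extSec I G B := ⟨vecSec I G B X, polySec_le (vecSec_mem X)⟩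

/-- The unit of the algebra of sections of the exterior bundle. -/
def oneExt : extSec I G B := ⟨1, polySec_le (one_mem _)⟩

theorem fnExt_mem (f : C^∞⟮I, M; ℝ⟯) : (fnExt f : extSec I G B) ∈ (extAlg I G B).deg 0 :=
  fun _ => algebraMap_mem_extDeg _

theorem vecExt_mem (X : Cₛ^∞⟮I; G, B⟯) : vecExt X ∈ (extAlg I G B).deg 1 :=
  fun _ => ι_mem_extDeg _

theorem oneExt_mem : (oneExt : extSec I G B) ∈ (extAlg I G B).deg 0 := fun x => by
  have := algebraMap_mem_extDeg (V := B x) 1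
  rwa [map_one] at this

theorem mul_apply (a b : extSec I G B) (x : M) :
    ((extAlg I G B).mul a b).1 x = a.1 x * b.1 x := rfl

theorem fnExt_apply (f : C^∞⟮I, M; ℝ⟯) (x : M) :
    (fnExt f : extSec I G B).1 x = algebraMap ℝ _ (f x) := rfl

theorem vecExt_apply (X : Cₛ^∞⟮I; G, B⟯) (x : M) :
    (vecExt X).1 x = ExteriorAlgebra.ι ℝ (X x) := rfl

theorem mul_oneExt (a : extSec I G B) : (extAlg I G B).mul a oneExt = a :=
  Subtype.ext (mul_one a.1)

theorem oneExt_mul (a : extSec I G B) : (extAlg I G B).mul oneExt a = a :=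
  Subtype.ext (one_mul a.1)

section Locality

variable [FiniteDimensional ℝ E] [IsManifold I ∞ M] [T2Space M]

theorem apply_eq_zero_of_eventually_eq_zero {k : ℕ} : ∀ {s : ℤ} {P : extSec I G B →ₗ[ℝ] extSec I G B}
    (_ : P ∈ (extAlg I G B).ordLT k s) {x : M} {u : extSec I G B}
    (_ : ∀ᶠ y in 𝓝 x, u.1 y = 0), (P u).1 x = 0 := by
  induction k with
  | zero =>
    intro s P hP x u hu
    rw [GCAlg.ordLT_zero, Submodule.mem_bot] at hP
    rw [hP]
    rfl
  | succ k ih =>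
    intro s P hP x u hu
    match k with
    | 0 =>
      obtain ⟨q, hq, rfl⟩ := (GCAlg.mem_ordLT_one _).1 hP
      rw [mul_apply, hu.self_of_nhds, mul_zero]
    | k + 1 =>
      obtain ⟨f, hf, hf'⟩ := exists_smooth_eq_zero_eq_one (I := I) hu
      have h1 : (extAlg I G B).mul (fnExt f) u = u := Subtype.ext <| funext fun y => by
        by_cases hy : u.1 y = 0
        · rw [mul_apply, hy, mul_zero]
        · rw [mul_apply, fnExt_apply, hf' y hy, map_one, one_mul]
      have h2 := ih (((GCAlg.mem_ordLT_add_two _).1 hP).2 0 _ (fnExt_mem f)) hu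
      rw [GCAlg.gcomm_apply, mul_zero, zpow_zero, one_smul, LinearMap.sub_apply,
        LinearMap.comp_apply, LinearMap.comp_apply, h1] at h2
      change (P u).1 x - (fnExt f).1 x * (P u).1 x = 0 at h2
      rwa [fnExt_apply, hf, map_zero, zero_mul, sub_zero] at h2

/-- Differential operators are local. -/
theorem eventually_apply_eq {k : ℕ} {s : ℤ} {P : extSec I G B →ₗ[ℝ] extSec I G B}
    (hP : P ∈ (extAlg I G B).ordLT k s) {x : M} {u v : extSec I G B}
    (h : ∀ᶠ y in 𝓝 x, u.1 y = v.1 y) : ∀ᶠ y in 𝓝 x, (P u).1 y = (P v).1 y := by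
  filter_upwards [h.eventually_nhds] with y hy
  have := apply_eq_zero_of_eventually_eq_zero hP (u := u - v) (hy.mono fun z hz => sub_eq_zero.2 hz)
  rw [map_sub] at this
  exact sub_eq_zero.1 this

/-- An operator that agrees near each point with a differential operator is one. -/
theorem mem_ordLT_of_locally {k : ℕ} : ∀ {s : ℤ} {P : extSec I G B →ₗ[ℝ] extSec I G B}
    (_ : P ∈ (extAlg I G B).shift s)
    (_ : ∀ x, ∃ Q ∈ (extAlg I G B).ordLT k s, ∀ b, ∀ᶠ y in 𝓝 x, (P b).1 y = (Q b).1 y),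
    P ∈ (extAlg I G B).ordLT k s := by
  induction k with
  | zero =>
    intro s P hP h
    rw [GCAlg.ordLT_zero, Submodule.mem_bot]
    refine LinearMap.ext fun b => Subtype.ext (funext fun x => ?_)
    obtain ⟨Q, hQ, h⟩ := h x
    rw [GCAlg.ordLT_zero, Submodule.mem_bot] at hQ
    rw [(h b).self_of_nhds, hQ]
  | succ k ih =>
    intro s P hP h
    match k with
    | 0 =>
      -- The local multipliers glue because each of them is recovered as the value of P on the unit.
      refine (GCAlg.mem_ordLT_one _).2 ⟨P oneExt, ?_, ?_⟩
      · have := hP 0 _ oneExt_mem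
        rwa [zero_add] at this
      · refine LinearMap.ext fun b => Subtype.ext (funext fun x => ?_)
        obtain ⟨Q, hQ, h⟩ := h x
        obtain ⟨q, hq, rfl⟩ := (GCAlg.mem_ordLT_one _).1 hQ
        rw [(h b).self_of_nhds, mul_apply, (h _).self_of_nhds, mul_oneExt, mul_apply]
    | k + 1 =>
      refine (GCAlg.mem_ordLT_add_two _).2 ⟨hP, fun j a ha => ih ?_ fun x => ?_⟩
      · exact GCAlg.gcomm_mem_shift _ hP (GCAlg.ordLT_le_shift _ _ _
          ((GCAlg.mem_ordLT_one _).2 ⟨a, ha, rfl⟩))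
      · obtain ⟨Q, hQ, h⟩ := h x
        refine ⟨_, ((GCAlg.mem_ordLT_add_two _).1 hQ).2 j a ha, fun b => ?_⟩
        filter_upwards [h b, h ((extAlg I G B).mul a b)] with y h1 h2
        change (P ((extAlg I G B).mul a b)).1 y - (-1 : ℝ) ^ (s * j) • (a.1 y * (P b).1 y) =
          (Q ((extAlg I G B).mul a b)).1 y - (-1 : ℝ) ^ (s * j) • (a.1 y * (Q b).1 y)
        rw [h1, h2]

/-- P is local, so near x the commutator [P, a] depends only on the germ of a at x; a different
representative c may be used at each point. -/
theorem gcomm_mul_mem_of_locally {k l : ℕ} {s j : ℤ} {P : extSec I G B →ₗ[ℝ] extSec I G B}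
    (hP : P ∈ (extAlg I G B).ordLT l s) {a : extSec I G B} (ha : a ∈ (extAlg I G B).deg j)
    (h : ∀ x, ∃ c : extSec I G B, (∀ᶠ y in 𝓝 x, a.1 y = c.1 y) ∧
      GCAlg.gcomm s j P ((extAlg I G B).mul c) ∈ (extAlg I G B).ordLT k (s + j)) :
    GCAlg.gcomm s j P ((extAlg I G B).mul a) ∈ (extAlg I G B).ordLT k (s + j) := by
  refine mem_ordLT_of_locally (GCAlg.gcomm_mem_shift _ (GCAlg.ordLT_le_shift _ _ _ hP)
    (GCAlg.ordLT_le_shift _ _ _ ((GCAlg.mem_ordLT_one _).2 ⟨a, ha, rfl⟩))) fun x => ?_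
  obtain ⟨c, hc, hc'⟩ := h x
  refine ⟨_, hc', fun b => ?_⟩
  have h1 : ∀ᶠ y in 𝓝 x, ((extAlg I G B).mul a b).1 y = ((extAlg I G B).mul c b).1 y :=
    hc.mono fun y hy => by rw [mul_apply, mul_apply, hy]
  filter_upwards [eventually_apply_eq hP h1, hc] with y h2 h3
  change (P ((extAlg I G B).mul a b)).1 y - (-1 : ℝ) ^ (s * j) • (a.1 y * (P b).1 y) =
    (P ((extAlg I G B).mul c b)).1 y - (-1 : ℝ) ^ (s * j) • (c.1 y * (P b).1 y)
  rw [h2, h3]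

end Locality

/-- The homogeneous polynomials in smooth functions and smooth sections. -/
inductive HomPoly : ℕ → extSec I G B → Prop
  | zero (n : ℕ) : HomPoly n 0
  | one : HomPoly 0 oneExt
  | add {n : ℕ} {a b : extSec I G B} : HomPoly n a → HomPoly n b → HomPoly n (a + b)
  | smul {n : ℕ} (c : ℝ) {a : extSec I G B} : HomPoly n a → HomPoly n (c • a)
  | fn {n : ℕ} (f : C^∞⟮I, M; ℝ⟯) {a : extSec I G B} :
      HomPoly n a → HomPoly n ((extAlg I G B).mul (fnExt f) a)
  | vec {n : ℕ} (X : Cₛ^∞⟮I; G, B⟯) {a : extSec I G B} :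
      HomPoly n a → HomPoly (n + 1) ((extAlg I G B).mul (vecExt X) a)

theorem HomPoly.mem_deg {n : ℕ} {a : extSec I G B} (ha : HomPoly n a) :
    a ∈ (extAlg I G B).deg n := by
  induction ha with
  | zero n => exact Submodule.zero_mem _
  | one => exact oneExt_mem
  | add _ _ ha hb => exact add_mem ha hb
  | smul c _ ha => exact Submodule.smul_mem _ c ha
  | fn f _ ha =>
    have := (extAlg I G B).mul_mem (fnExt_mem f) ha
    rwa [zero_add] at this
  | vec X _ ha =>
    have := (extAlg I G B).mul_mem (vecExt_mem X) ha
    rwa [add_comm] at this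

/-- The polynomials in `polySec` mix degrees, while the graded commutator needs a degree. Projection
to one degree is linear over functions and shifts by one past a section, so components of
polynomials are again polynomials. -/
theorem exists_homPoly_proj {a : (x : M) → ExteriorAlgebra ℝ (B x)} (ha : a ∈ polySec I G B) :
    ∀ n : ℕ, ∃ c : extSec I G B, HomPoly n c ∧ ∀ x, c.1 x = extProj n (a x) := by
  refine polySec_induction (p := fun a => ∀ n : ℕ, ∃ c : extSec I G B, HomPoly n c ∧
      ∀ x, c.1 x = extProj n (a x)) ?_ ?_ ?_ ?_ ?_ ha
  · intro a b ha hb n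
    obtain ⟨c, hc, h⟩ := ha n
    obtain ⟨d, hd, h'⟩ := hb n
    exact ⟨c + d, hc.add hd, fun x => by
      rw [Pi.add_apply, map_add, ← h, ← h']
      rfl⟩
  · intro r a ha n
    obtain ⟨c, hc, h⟩ := ha n
    exact ⟨r • c, hc.smul r, fun x => by
      rw [Pi.smul_apply, map_smul, ← h]
      rfl⟩
  · intro n
    by_cases hn : n = 0
    · subst hn
      exact ⟨oneExt, .one, fun x => (extProj_of_mem (oneExt_mem x)).symm⟩
    · exact ⟨0, .zero n, fun x => (extProj_one_of_ne hn).symm⟩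
  · intro f a _ ha n
    obtain ⟨c, hc, h⟩ := ha n
    exact ⟨_, hc.fn f, fun x => by
      rw [mul_apply, h, fnExt_apply, ← Algebra.smul_def, ← map_smul, Algebra.smul_def]
      rfl⟩
  · intro X a _ ha n
    match n with
    | 0 => exact ⟨0, .zero 0, fun x => (extProj_zero_ι_mul _ _).symm⟩
    | n + 1 =>
      obtain ⟨c, hc, h⟩ := ha n
      exact ⟨_, hc.vec X, fun x => by
        rw [mul_apply, h]
        exact (extProj_succ_ι_mul _ _ _).symm⟩

theorem exists_homPoly_eventually_eq {n : ℕ} {a : extSec I G B} (ha : a ∈ (extAlg I G B).deg n)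
    (x : M) : ∃ c : extSec I G B, HomPoly n c ∧ ∀ᶠ y in 𝓝 x, a.1 y = c.1 y := by
  obtain ⟨η, hη, h⟩ := a.2 x
  obtain ⟨c, hc, h'⟩ := exists_homPoly_proj hη n
  refine ⟨c, hc, h.mono fun y hy => ?_⟩
  rw [h', ← hy, extProj_of_mem (ha y)]

theorem eq_zero_of_mem_deg_neg {j : ℤ} (hj : j < 0) {a : extSec I G B}
    (ha : a ∈ (extAlg I G B).deg j) : a = 0 := by
  match j with
  | Int.ofNat _ => exact absurd hj (by simp)
  | Int.negSucc _ => exact Subtype.ext (funext fun x => ha x)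

/-- Leibniz rule, along the recursive construction of the polynomial. -/
theorem gcomm_homPoly_mem {k : ℕ} {s : ℤ} {P : extSec I G B →ₗ[ℝ] extSec I G B}
    (h1 : GCAlg.gcomm s 0 P ((extAlg I G B).mul oneExt) ∈ (extAlg I G B).ordLT k s)
    (hf : ∀ f : C^∞⟮I, M; ℝ⟯,
      GCAlg.gcomm s 0 P ((extAlg I G B).mul (fnExt f)) ∈ (extAlg I G B).ordLT k s)
    (hX : ∀ X : Cₛ^∞⟮I; G, B⟯,
      GCAlg.gcomm s 1 P ((extAlg I G B).mul (vecExt X)) ∈ (extAlg I G B).ordLT k (s + 1))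
    {n : ℕ} {a : extSec I G B} (ha : HomPoly n a) :
    GCAlg.gcomm s n P ((extAlg I G B).mul a) ∈ (extAlg I G B).ordLT k (s + n) := by
  induction ha with
  | zero n =>
    rw [map_zero, map_zero]
    exact Submodule.zero_mem _
  | one => simpa using h1
  | add _ _ ha hb =>
    rw [map_add, map_add]
    exact add_mem ha hb
  | smul c _ ha =>
    rw [map_smul, map_smul]
    exact Submodule.smul_mem _ c ha
  | @fn n f a ha ih =>
    have := GCAlg.gcomm_mul_mul_mem (fnExt_mem f) ha.mem_deg (by rw [add_zero]; exact hf f) ih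
    rwa [zero_add] at this
  | @vec n X a ha ih =>
    have := GCAlg.gcomm_mul_mul_mem (vecExt_mem X) ha.mem_deg (hX X) ih
    rwa [add_comm 1 (n : ℤ)] at this

/-- The lowest-order case: an operator commuting with all generators is determined on polynomials by
its value on the unit. -/
theorem apply_eq_mul_of_gcomm_eq_zero {s : ℤ} {P : extSec I G B →ₗ[ℝ] extSec I G B}
    (h1 : P oneExt ∈ (extAlg I G B).deg s)
    (hf : ∀ f : C^∞⟮I, M; ℝ⟯, GCAlg.gcomm s 0 P ((extAlg I G B).mul (fnExt f)) = 0)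
    (hX : ∀ X : Cₛ^∞⟮I; G, B⟯, GCAlg.gcomm s 1 P ((extAlg I G B).mul (vecExt X)) = 0)
    {a : (x : M) → ExteriorAlgebra ℝ (B x)} (ha : a ∈ polySec I G B) :
    P ⟨a, polySec_le ha⟩ = (extAlg I G B).mul (P oneExt) ⟨a, polySec_le ha⟩ := by
  suffices h : ∃ c : extSec I G B, c.1 = a ∧ P c = (extAlg I G B).mul (P oneExt) c by
    obtain ⟨c, rfl, h⟩ := h
    exact h
  refine polySec_induction (p := fun a => ∃ c : extSec I G B, c.1 = a ∧
    P c = (extAlg I G B).mul (P oneExt) c) ?_ ?_ ?_ ?_ ?_ ha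
  · rintro _ _ ⟨c, rfl, hc⟩ ⟨d, rfl, hd⟩
    exact ⟨c + d, rfl, by rw [map_add, map_add, hc, hd]⟩
  · rintro r _ ⟨c, rfl, hc⟩
    exact ⟨r • c, rfl, by rw [map_smul, map_smul, hc]⟩
  · exact ⟨oneExt, rfl, (mul_oneExt _).symm⟩
  · rintro f _ - ⟨c, rfl, hc⟩
    refine ⟨(extAlg I G B).mul (fnExt f) c, rfl, ?_⟩
    have h := LinearMap.congr_fun (hf f) c
    rw [GCAlg.gcomm_apply, mul_zero, zpow_zero, one_smul] at h
    refine (sub_eq_zero.1 h).trans ?_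
    rw [LinearMap.comp_apply, hc, ← (extAlg I G B).mul_assoc, (extAlg I G B).comm (fnExt_mem f) h1,
      zero_mul, zpow_zero, one_smul, (extAlg I G B).mul_assoc]
  · rintro X _ - ⟨c, rfl, hc⟩
    refine ⟨(extAlg I G B).mul (vecExt X) c, rfl, ?_⟩
    have h := LinearMap.congr_fun (hX X) c
    rw [GCAlg.gcomm_apply, mul_one] at h
    refine (sub_eq_zero.1 h).trans ?_
    rw [LinearMap.smul_apply, LinearMap.comp_apply, hc, ← (extAlg I G B).mul_assoc,
      (extAlg I G B).comm (vecExt_mem X) h1, one_mul, map_smul, LinearMap.smul_apply, smul_smul,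
      GCAlg.neg_one_zpow_mul_self, one_smul, (extAlg I G B).mul_assoc]

variable [FiniteDimensional ℝ E] [IsManifold I ∞ M] [T2Space M]

/-- A differential operator whose commutators with functions and with sections of degree one have
order `< k` has order `< k + 1`. -/
theorem mem_ordLT_of_gcomm_mem {k l : ℕ} {s : ℤ} {P : extSec I G B →ₗ[ℝ] extSec I G B}
    (hP : P ∈ (extAlg I G B).ordLT l s)
    (hf : ∀ f : C^∞⟮I, M; ℝ⟯,
      GCAlg.gcomm s 0 P ((extAlg I G B).mul (fnExt f)) ∈ (extAlg I G B).ordLT k s)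
    (hX : ∀ X : Cₛ^∞⟮I; G, B⟯,
      GCAlg.gcomm s 1 P ((extAlg I G B).mul (vecExt X)) ∈ (extAlg I G B).ordLT k (s + 1)) :
    P ∈ (extAlg I G B).ordLT (k + 1) s := by
  have h1 : GCAlg.gcomm s 0 P ((extAlg I G B).mul oneExt) ∈ (extAlg I G B).ordLT k s := by
    have : GCAlg.gcomm s 0 P ((extAlg I G B).mul oneExt) = 0 := LinearMap.ext fun b => by
      rw [GCAlg.gcomm_apply, mul_zero, zpow_zero, one_smul, LinearMap.sub_apply,
        LinearMap.comp_apply, LinearMap.comp_apply, oneExt_mul, oneExt_mul, sub_self,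
        LinearMap.zero_apply]
    rw [this]
    exact Submodule.zero_mem _
  -- A homogeneous form is near each point a homogeneous polynomial, to which the Leibniz rule
  -- applies. The bound `l` on the order of P is arbitrary: it serves only for locality and for the
  -- degree of P.
  have key : ∀ (j : ℤ) (a : extSec I G B), a ∈ (extAlg I G B).deg j →
      GCAlg.gcomm s j P ((extAlg I G B).mul a) ∈ (extAlg I G B).ordLT k (s + j) := by
    intro j a ha
    by_cases hj : j < 0
    · rw [eq_zero_of_mem_deg_neg hj ha, map_zero, map_zero]
      exact Submodule.zero_mem _
    · lift j to ℕ using not_lt.1 hj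
      refine gcomm_mul_mem_of_locally hP ha fun x => ?_
      obtain ⟨c, hc, h⟩ := exists_homPoly_eventually_eq ha x
      exact ⟨c, h, gcomm_homPoly_mem h1 hf hX hc⟩
  match k with
  | 0 =>
    simp only [GCAlg.ordLT_zero, Submodule.mem_bot] at hf hX
    have h1 : P oneExt ∈ (extAlg I G B).deg s := by
      have := GCAlg.ordLT_le_shift _ _ _ hP 0 _ oneExt_mem
      rwa [zero_add] at this
    refine (GCAlg.mem_ordLT_one _).2 ⟨P oneExt, h1, LinearMap.ext fun b =>
      Subtype.ext (funext fun x => ?_)⟩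
    obtain ⟨η, hη, h⟩ := b.2 x
    rw [(eventually_apply_eq hP (v := ⟨η, polySec_le hη⟩) h).self_of_nhds,
      apply_eq_mul_of_gcomm_eq_zero h1 hf hX hη, mul_apply, mul_apply, h.self_of_nhds]
  | k + 1 => exact (GCAlg.mem_ordLT_add_two _).2 ⟨GCAlg.ordLT_le_shift _ _ _ hP, key⟩

end LocalOperators

end BigBracket

namespace BigBracket

/-! ### Pointwise commutators of contractions, derivations and exterior multiplications. -/

section PointwiseCommutators

variable {V W : Type*} [AddCommGroup V] [Module ℝ V] [AddCommGroup W] [Module ℝ W]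

theorem exists_algebraMap_of_mem_extDeg_zero {a : ExteriorAlgebra ℝ W} (ha : a ∈ extDeg W 0) :
    ∃ r : ℝ, a = algebraMap ℝ _ r := by
  change a ∈ LinearMap.range (ExteriorAlgebra.ι ℝ : W →ₗ[ℝ] _) ^ 0 at ha
  rw [pow_zero] at ha
  obtain ⟨r, rfl⟩ := Submodule.mem_one.1 ha
  exact ⟨r, rfl⟩

/-- Contracting with a basis and multiplying by the dual basis is multiplication by the degree. -/
theorem sum_ι_mul_contractLeft {ι : Type*} [Fintype ι] (e : ι → W) (d : ι → Module.Dual ℝ W)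
    (h : ∀ w, ∑ i, d i w • e i = w) {j : ℤ} {a : ExteriorAlgebra ℝ W} (ha : a ∈ extDeg W j) :
    ∑ i, ExteriorAlgebra.ι ℝ (e i) * CliffordAlgebra.contractLeft (d i) a = (j : ℝ) • a := by
  refine extDeg_induction (p := fun j a => ∑ i, ExteriorAlgebra.ι ℝ (e i) *
    CliffordAlgebra.contractLeft (d i) a = (j : ℝ) • a) ?_ ?_ ?_ ?_ ha
  · simp
  · intro j a b ha hb
    simp only [map_add, mul_add, Finset.sum_add_distrib, ha, hb, smul_add]
  · intro r
    simp [CliffordAlgebra.contractLeft_algebraMap]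
  · intro j w a _ ih
    have h1 : ∀ i, ExteriorAlgebra.ι ℝ (e i) *
        CliffordAlgebra.contractLeft (d i) (ExteriorAlgebra.ι ℝ w * a) =
        ExteriorAlgebra.ι ℝ (d i w • e i) * a + ExteriorAlgebra.ι ℝ w *
          (ExteriorAlgebra.ι ℝ (e i) * CliffordAlgebra.contractLeft (d i) a) := fun i => by
      have h2 : ExteriorAlgebra.ι ℝ (e i) * ExteriorAlgebra.ι ℝ w =
          -(ExteriorAlgebra.ι ℝ w * ExteriorAlgebra.ι ℝ (e i)) :=
        eq_neg_of_add_eq_zero_left (ExteriorAlgebra.ι_add_mul_swap _ _)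
      rw [ExteriorAlgebra.ι, CliffordAlgebra.contractLeft_ι_mul, mul_sub, ← mul_assoc, mul_smul_comm]
      rw [ExteriorAlgebra.ι] at h2
      rw [h2, neg_mul, sub_neg_eq_add, map_smul, smul_mul_assoc, mul_assoc]
    rw [Finset.sum_congr rfl fun i _ => h1 i, Finset.sum_add_distrib, ← Finset.sum_mul,
      ← Finset.mul_sum, ih, ← map_sum, h]
    push_cast
    rw [mul_smul_comm, add_smul, one_smul, add_comm]

/-- In commutator form, [D_T, i_d] = -i_{d ∘ T}. For T the transpose of N this is the statement that
N sends i_X to i_{NX}, up to the sign from the order in {X, N}. -/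
theorem extDer_contractLeft (T : W →ₗ[ℝ] W) (d : Module.Dual ℝ W) (a : ExteriorAlgebra ℝ W) :
    extDer T (CliffordAlgebra.contractLeft d a) =
      CliffordAlgebra.contractLeft d (extDer T a) - CliffordAlgebra.contractLeft (d ∘ₗ T) a := by
  induction a using CliffordAlgebra.left_induction with
  | algebraMap r =>
    have : extDer T (algebraMap ℝ (CliffordAlgebra (0 : QuadraticForm ℝ W)) r) = 0 :=
      extDer_algebraMap T r
    rw [CliffordAlgebra.contractLeft_algebraMap, CliffordAlgebra.contractLeft_algebraMap, this,
      map_zero, map_zero, sub_zero]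
  | add x y hx hy =>
    simp only [map_add, hx, hy]
    abel
  | ι_mul x w hx =>
    have h1 : ∀ x, extDer T (CliffordAlgebra.ι 0 w * x) =
      CliffordAlgebra.ι 0 (T w) * x + CliffordAlgebra.ι 0 w * extDer T x := fun x => by
      have := extDer_mul T (ExteriorAlgebra.ι ℝ w) x
      rwa [extDer_ι] at this
    rw [CliffordAlgebra.contractLeft_ι_mul, CliffordAlgebra.contractLeft_ι_mul, map_sub, map_smul,
      h1, h1, map_add, CliffordAlgebra.contractLeft_ι_mul, CliffordAlgebra.contractLeft_ι_mul, hx,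
      mul_sub, LinearMap.comp_apply]
    abel

/-- In commutator form, [i_P, w ∧ ·] = -i_{P^♯ w}; the sign comes from the convention that u ∧ v
acts as i_u ∘ i_v. -/
theorem intProd_two_ι_mul (B : V →ₗ[ℝ] Module.Dual ℝ W) {P : ExteriorAlgebra ℝ V}
    (hP : P ∈ ⋀[ℝ]^2 V) (w : W) (a : ExteriorAlgebra ℝ W) :
    intProd B P (ExteriorAlgebra.ι ℝ w * a) = ExteriorAlgebra.ι ℝ w * intProd B P a -
      CliffordAlgebra.contractLeft
        (B (ExteriorAlgebra.ιInv (CliffordAlgebra.contractLeft (B.flip w) P))) a := by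
  refine exteriorPower_two_induction (p := fun P => intProd B P (ExteriorAlgebra.ι ℝ w * a) =
    ExteriorAlgebra.ι ℝ w * intProd B P a - CliffordAlgebra.contractLeft
      (B (ExteriorAlgebra.ιInv (CliffordAlgebra.contractLeft (B.flip w) P))) a) ?_ ?_ hP
  · intro P Q hP hQ
    simp only [map_add, LinearMap.add_apply, hP, hQ, mul_add]
    abel
  · intro u v
    have h1 : CliffordAlgebra.contractLeft (B.flip w)
        (ExteriorAlgebra.ι ℝ u * ExteriorAlgebra.ι ℝ v) =
        ExteriorAlgebra.ι ℝ (B u w • v - B v w • u) := by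
      rw [ExteriorAlgebra.ι, CliffordAlgebra.contractLeft_ι_mul, CliffordAlgebra.contractLeft_ι,
        ← Algebra.commutes, ← Algebra.smul_def, map_sub, map_smul, map_smul]
      rfl
    rw [h1, ExteriorAlgebra.ι_leftInverse]
    simp only [map_mul, Module.End.mul_apply, intProd_ι]
    rw [ExteriorAlgebra.ι, CliffordAlgebra.contractLeft_ι_mul, map_sub, map_smul,
      CliffordAlgebra.contractLeft_ι_mul, map_sub, map_smul, map_smul, LinearMap.map_sub₂,
      LinearMap.map_smul₂, LinearMap.map_smul₂]
    abel

end PointwiseCommutators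

/-! ### Separation by covectors and vectors in a fibre. -/

section Fibres

variable {M : Type*} [TopologicalSpace M] {A : M → Type*} [∀ x, AddCommGroup (A x)]
  [∀ x, Module ℝ (A x)] [∀ x, TopologicalSpace (A x)]
  [∀ x, IsTopologicalAddGroup (A x)] [∀ x, ContinuousSMul ℝ (A x)]

theorem exists_dual_basis (F : Type*) [NormedAddCommGroup F] [NormedSpace ℝ F] [FiniteDimensional ℝ F]
    [TopologicalSpace (Bundle.TotalSpace F A)] [FiberBundle F A] [VectorBundle ℝ F A]
    (x : M) : ∃ (n : ℕ) (b : Fin n → A x) (e : Fin n → A x →L[ℝ] ℝ),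
    ∀ v, ∑ i, e i v • b i = v := by
  let φ : A x ≃L[ℝ] F := (trivializationAt F A x).continuousLinearEquivAt ℝ x
    (FiberBundle.mem_baseSet_trivializationAt' x)
  let c := Module.finBasis ℝ F
  refine ⟨_, fun i => φ.symm (c i),
    fun i => (LinearMap.toContinuousLinearMap (c.coord i)).comp (φ : A x →L[ℝ] F), fun v => ?_⟩
  apply φ.injective
  rw [map_sum]
  simp only [map_smul, ContinuousLinearEquiv.apply_symm_apply]
  exact c.sum_repr (φ v)

theorem eq_zero_of_forall_covector_eq_zero (F : Type*) [NormedAddCommGroup F] [NormedSpace ℝ F] [FiniteDimensional ℝ F]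
    [TopologicalSpace (Bundle.TotalSpace F A)] [FiberBundle F A] [VectorBundle ℝ F A]
    {x : M} {v : A x} (h : ∀ α : A x →L[ℝ] ℝ, α v = 0) :
    v = 0 := by
  obtain ⟨n, b, e, hbe⟩ := exists_dual_basis F (A := A) x
  rw [← hbe v]
  exact Finset.sum_eq_zero fun i _ => by rw [h, zero_smul]

/-- In dual bases, j a = ∑ e_i ∧ i_{b_i} a for a of degree j. Scalars are killed by all
contractions, hence the condition j ≠ 0. -/
theorem eq_zero_of_contractLeft_eq_zero (F : Type*) [NormedAddCommGroup F] [NormedSpace ℝ F] [FiniteDimensional ℝ F]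
    [TopologicalSpace (Bundle.TotalSpace F A)] [FiberBundle F A] [VectorBundle ℝ F A]
    {x : M} {j : ℤ} (hj : j ≠ 0)
    {a : ExteriorAlgebra ℝ (A x →L[ℝ] ℝ)} (ha : a ∈ extDeg (A x →L[ℝ] ℝ) j)
    (h : ∀ v : A x, CliffordAlgebra.contractLeft (evalAt x v) a = 0) : a = 0 := by
  obtain ⟨n, b, e, hbe⟩ := exists_dual_basis F (A := A) x
  have := sum_ι_mul_contractLeft e (fun i => evalAt x (b i)) (fun α => by
    ext v
    conv_rhs => rw [← hbe v]
    rw [map_sum, sum_apply]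
    refine Finset.sum_congr rfl fun i _ => ?_
    rw [map_smul, smul_apply, smul_eq_mul, smul_eq_mul, mul_comm]
    rfl) ha
  rw [Finset.sum_eq_zero fun i _ => by rw [h, mul_zero]] at this
  exact (smul_eq_zero.1 this.symm).resolve_left (Int.cast_ne_zero.2 hj)

end Fibres

end BigBracket

namespace BigBracket

/-! ### Vanishing criteria for symbols, and the action of N and N². -/

section Symbols

open GCAlg

variable {E H M : Type*} [NormedAddCommGroup E] [NormedSpace ℝ E] [FiniteDimensional ℝ E]
  [TopologicalSpace H] {I : ModelWithCorners ℝ E H} [TopologicalSpace M] [ChartedSpace H M]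
  [IsManifold I ∞ M] [T2Space M]
  {F : Type*} [NormedAddCommGroup F] [NormedSpace ℝ F] [FiniteDimensional ℝ F]
  {A : M → Type*} [∀ x, AddCommGroup (A x)] [∀ x, Module ℝ (A x)]
  [TopologicalSpace (Bundle.TotalSpace F A)] [∀ x, TopologicalSpace (A x)]
  [∀ x, IsTopologicalAddGroup (A x)] [∀ x, ContinuousSMul ℝ (A x)]
  [FiberBundle F A] [VectorBundle ℝ F A] [ContMDiffVectorBundle ∞ F A I]

theorem ofFn_mem (f : C^∞⟮I, M; ℝ⟯) : (ofFn f : BigAlg I F A) ∈ (formAlg I F A).hom 0 0 :=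
  symb_mem_hom _

theorem ofOneForm_mem (α : OneForm I F A) : ofOneForm α ∈ (formAlg I F A).hom 0 1 :=
  symb_mem_hom _

theorem ofVec_mem (X : Vec I F A) : ofVec X ∈ (formAlg I F A).hom 1 (-1) := symb_mem_hom _

theorem ofTensor_mem (N : EndTensor I F A) : ofTensor N ∈ (formAlg I F A).hom 1 0 :=
  symb_mem_hom _

theorem ofBivector_mem (π : Bivector I F A) : ofBivector π ∈ (formAlg I F A).hom 2 (-2) :=
  symb_mem_hom _

/-- A symbol of positive order is zero if its brackets with functions and `1`-forms vanish. -/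
theorem eq_zero_of_bracket_eq_zero {k : ℕ} {s : ℤ} {u : BigAlg I F A}
    (hu : u ∈ (formAlg I F A).hom (k + 1) s) (hf : ∀ f : C^∞⟮I, M; ℝ⟯, ⁅u, (ofFn f : BigAlg I F A)⁆ = 0)
    (hα : ∀ α : OneForm I F A, ⁅u, ofOneForm α⁆ = 0) : u = 0 := by
  obtain ⟨P, hP, rfl⟩ := exists_symb hu
  refine (symb_eq_zero hP).2 (mem_ordLT_of_gcomm_mem hP (fun f => ?_) fun α => ?_)
  · have := hf f
    rw [ofFn, bracket_symb, symb_eq_zero, add_zero s] at this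
    exact this
  · have := hα α
    rw [ofOneForm, bracket_symb, symb_eq_zero] at this
    exact this

/-- An operator of order k can lower the degree by at most k, up to lower order. Commuting with a
function decreases k + s by one; commuting with a 1-form lowers k, raises s and leaves k + s
unchanged. The induction ends at multiplication by a form of negative degree. -/
theorem ordLT_le_of_add_neg {k : ℕ} : ∀ {s : ℤ}, k + s < 0 →
    (formAlg I F A).ordLT (k + 1) s ≤ (formAlg I F A).ordLT k s := by
  induction k with
  | zero =>
    intro s hs P hP
    obtain ⟨q, hq, rfl⟩ := (mem_ordLT_one _).1 hP
    rw [eq_zero_of_mem_deg_neg (by simpa using hs) hq, map_zero]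
    exact Submodule.zero_mem _
  | succ k ih =>
    intro s hs P hP
    have h := ((mem_ordLT_add_two _).1 hP).2
    refine mem_ordLT_of_gcomm_mem hP (fun f => ?_) fun α => ?_
    · have := h 0 _ (fnExt_mem f)
      rw [add_zero] at this
      exact ih (by push_cast at hs; omega) this
    · exact ih (by push_cast at hs; omega) (h 1 _ (vecExt_mem α))

/-- There are no nonzero elements of bidegree `(k, l)` with `l < 0`. -/
theorem eq_zero_of_mem_hom {k : ℕ} {s : ℤ} {u : BigAlg I F A} (hu : u ∈ (formAlg I F A).hom k s)
    (hs : k + s < 0) : u = 0 := by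
  obtain ⟨P, hP, rfl⟩ := exists_symb hu
  exact (symb_eq_zero hP).2 (ordLT_le_of_add_neg hs hP)

/-- Near a point α = ∑ g_i β_i with β_i exact. The bracket with u is local and a derivation, so
vanishing on functions and exact forms gives vanishing on α. -/
theorem exactForms_bracket_eq_zero {μ : BigAlg I F A} (h : ExactFormsGenerate μ) {k : ℕ} {s : ℤ}
    {u : BigAlg I F A} (hu : u ∈ (formAlg I F A).hom (k + 1) s)
    (hf : ∀ f : C^∞⟮I, M; ℝ⟯, ⁅u, (ofFn f : BigAlg I F A)⁆ = 0)
    (hβ : ∀ β : OneForm I F A, IsExactOneForm μ β → ⁅u, ofOneForm β⁆ = 0) : u = 0 := by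
  obtain ⟨P, hP, rfl⟩ := exists_symb hu
  refine eq_zero_of_bracket_eq_zero hu hf fun α => ?_
  have hf' : ∀ f : C^∞⟮I, M; ℝ⟯,
      gcomm s 0 P ((formAlg I F A).mul (fnExt f)) ∈ (formAlg I F A).ordLT k (s + 0) := fun f => by
    have := hf f
    rw [ofFn, bracket_symb, symb_eq_zero] at this
    exact this
  rw [ofOneForm, bracket_symb, symb_eq_zero]
  refine gcomm_mul_mem_of_locally (a := vecExt α) hP (vecExt_mem α) fun x => ?_
  obtain ⟨U, hU, h⟩ := h x
  obtain ⟨n, g, β, hβ', hα⟩ := h α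
  refine ⟨∑ i, (formAlg I F A).mul (fnExt (g i)) (vecExt (β i)), ?_, ?_⟩
  · filter_upwards [hU] with y hy
    rw [vecExt_apply, hα y hy, map_sum, AddSubmonoidClass.coe_finsetSum, Finset.sum_apply]
    refine Finset.sum_congr rfl fun i _ => ?_
    rw [mul_apply, fnExt_apply, vecExt_apply, map_smul, Algebra.smul_def]
  · refine gcomm_mul_sum_mem _ _ _ _ fun i _ => ?_
    have h1 := hβ (β i) (hβ' i)
    rw [ofOneForm, bracket_symb, symb_eq_zero] at h1
    exact gcomm_mul_mul_mem (fnExt_mem (g i)) (vecExt_mem (β i)) (hf' (g i)) h1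

theorem gcomm_derOp_mul (N : EndTensor I F A) {j : ℤ} (a : Form I F A) :
    gcomm 0 j (derOp N) ((formAlg I F A).mul a) = (formAlg I F A).mul (derOp N a) :=
  LinearMap.ext fun b => Subtype.ext (funext fun x => by
    change extDer _ (a.1 x * b.1 x) - (-1 : ℝ) ^ (0 * j) • (a.1 x * extDer _ (b.1 x)) =
      extDer _ (a.1 x) * b.1 x
    rw [extDer_mul, zero_mul, zpow_zero, one_smul, add_sub_cancel_right])

theorem derOp_vecExt (N : EndTensor I F A) (α : OneForm I F A) :
    derOp N (vecExt α) = vecExt (transpose N α) :=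
  Subtype.ext (funext fun _ => extDer_ι _ _)

theorem bracket_ofTensor_ofOneForm (N : EndTensor I F A) (α : OneForm I F A) :
    ⁅ofTensor N, ofOneForm α⁆ = ofOneForm (transpose N α) := by
  rw [ofTensor, ofOneForm, bracket_symb]
  refine symb_congr _ rfl rfl ?_
  exact (gcomm_derOp_mul N (vecExt α)).trans (by rw [derOp_vecExt]; rfl)

theorem bracket_ofTensor_eq_zero (N : EndTensor I F A) {u : BigAlg I F A}
    (hu : u ∈ (formAlg I F A).hom 0 0) : ⁅ofTensor N, u⁆ = 0 := by
  obtain ⟨P, hP, rfl⟩ := exists_symb hu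
  obtain ⟨q, hq, rfl⟩ := (mem_ordLT_one _).1 hP
  have h : derOp N q = 0 := Subtype.ext (funext fun x => by
    obtain ⟨r, hr⟩ := exists_algebraMap_of_mem_extDeg_zero (hq x)
    change extDer _ (q.1 x) = 0
    rw [hr]
    exact extDer_algebraMap _ _)
  rw [ofTensor, bracket_symb, symb_eq_zero, gcomm_derOp_mul, h, map_zero]
  exact Submodule.zero_mem _

theorem bracket_ofBivector_eq_zero (π : Bivector I F A) {v : BigAlg I F A}
    (hv : v ∈ (formAlg I F A).hom 0 0) : ⁅ofBivector π, v⁆ = 0 :=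
  eq_zero_of_mem_hom (bracket_mem_hom (ofBivector_mem π) hv) (by norm_num)

theorem bracket_vector_eq_zero {u v : BigAlg I F A} (hu : u ∈ (formAlg I F A).hom 1 (-1))
    (hv : v ∈ (formAlg I F A).hom 0 0) : ⁅u, v⁆ = 0 :=
  eq_zero_of_mem_hom (bracket_mem_hom hu hv) (by norm_num)

/-- The square of a `(1,1)`-tensor. -/
def squareTensor (N : EndTensor I F A) : EndTensor I F A :=
  ⟨fun x => (N x).comp (N x), fun x => by
    have hN := N.contMDiff x
    rw [contMDiffAt_hom_bundle] at hN ⊢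
    refine ⟨contMDiffAt_id, (hN.2.clm_comp hN.2).congr_of_eventuallyEq ?_⟩
    filter_upwards [(trivializationAt F A x).open_baseSet.mem_nhds
      (FiberBundle.mem_baseSet_trivializationAt' x)] with y hy
    ext v
    erw [ContinuousLinearMap.inCoordinates_eq hy hy, ContinuousLinearMap.inCoordinates_eq hy hy]
    simp [Bundle.Trivialization.symm_apply_apply_mk _ hy]⟩

theorem bracket_ofTensor_ofTensor_ofOneForm (N : EndTensor I F A) (α : OneForm I F A) :
    ⁅ofTensor N, ⁅ofTensor N, ofOneForm α⁆⁆ = ⁅ofTensor (squareTensor N), ofOneForm α⁆ := by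
  rw [bracket_ofTensor_ofOneForm, bracket_ofTensor_ofOneForm, bracket_ofTensor_ofOneForm]
  rfl

/-- The remaining Jacobi term is the bracket of N with the function {u, α}, which is zero. -/
theorem bracket_bracket_ofTensor_ofOneForm (N : EndTensor I F A) {u : BigAlg I F A}
    (hu : u ∈ (formAlg I F A).hom 1 (-1)) (α : OneForm I F A) :
    ⁅⁅u, ofTensor N⁆, ofOneForm α⁆ = ⁅u, ⁅ofTensor N, ofOneForm α⁆⁆ := by
  have h := bracket_jacobi_even hu (ofTensor_mem N) (ofOneForm_mem α) (by norm_num)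
  have h1 : ⁅u, ofOneForm α⁆ ∈ (formAlg I F A).hom 0 0 :=
    bracket_mem_hom_of_eq hu (ofOneForm_mem α) (by norm_num) (by norm_num)
  rw [h, bracket_ofTensor_eq_zero N h1, add_zero]

theorem bracket_ofTensor_mem (N : EndTensor I F A) {u : BigAlg I F A} {k : ℕ} {s : ℤ}
    (hu : u ∈ (formAlg I F A).hom k s) : ⁅u, ofTensor N⁆ ∈ (formAlg I F A).hom k s :=
  bracket_mem_hom_of_eq hu (ofTensor_mem N) (by omega) (by omega)

/-- On sections of `A`, the square of `N` acts as applying `N` twice. -/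
theorem bracket_bracket_ofTensor (N : EndTensor I F A) {u : BigAlg I F A}
    (hu : u ∈ (formAlg I F A).hom 1 (-1)) :
    ⁅⁅u, ofTensor N⁆, ofTensor N⁆ = ⁅u, ofTensor (squareTensor N)⁆ := by
  have h1 := bracket_ofTensor_mem N hu
  have h2 := sub_mem (bracket_ofTensor_mem N h1) (bracket_ofTensor_mem (squareTensor N) hu)
  -- An element of order 1 and degree -1 brackets to zero with functions, so only 1-forms need
  -- testing; on them both sides act through the twice transposed N.
  refine sub_eq_zero.1 (eq_zero_of_bracket_eq_zero h2 (fun f => bracket_vector_eq_zero h2 (ofFn_mem f)) fun α => ?_)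
  rw [sub_bracket, bracket_bracket_ofTensor_ofOneForm _ h1, bracket_ofTensor_ofOneForm,
    bracket_bracket_ofTensor_ofOneForm _ hu, bracket_bracket_ofTensor_ofOneForm _ hu,
    ← bracket_ofTensor_ofOneForm, bracket_ofTensor_ofTensor_ofOneForm, sub_self]

end Symbols

end BigBracket

namespace BigBracket

/-! ### Interior products; the derived bracket determines the structure. -/

section Symbols

open GCAlg

variable {E H M : Type*} [NormedAddCommGroup E] [NormedSpace ℝ E] [FiniteDimensional ℝ E]
  [TopologicalSpace H] {I : ModelWithCorners ℝ E H} [TopologicalSpace M] [ChartedSpace H M]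
  [IsManifold I ∞ M] [T2Space M]
  {F : Type*} [NormedAddCommGroup F] [NormedSpace ℝ F] [FiniteDimensional ℝ F]
  {A : M → Type*} [∀ x, AddCommGroup (A x)] [∀ x, Module ℝ (A x)]
  [TopologicalSpace (Bundle.TotalSpace F A)] [∀ x, TopologicalSpace (A x)]
  [∀ x, IsTopologicalAddGroup (A x)] [∀ x, ContinuousSMul ℝ (A x)]
  [FiberBundle F A] [VectorBundle ℝ F A] [ContMDiffVectorBundle ∞ F A I]

/-- The interior product with a section of `A`, as an operator on forms. -/
def vecOp (X : Vec I F A) : Form I F A →ₗ[ℝ] Form I F A :=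
  interiorOp (vecSec I F A X) (polySec_le (vecSec_mem X))

theorem vecOp_apply (X : Vec I F A) (u : Form I F A) (x : M) :
    (vecOp X u).1 x = CliffordAlgebra.contractLeft (evalAt x (X x)) (u.1 x) :=
  interiorSec_vecSec X u.1 x

theorem vecOp_mem_deg (X : Vec I F A) {j : ℤ} {a : Form I F A} (ha : a ∈ (formAlg I F A).deg j) :
    vecOp X a ∈ (formAlg I F A).deg (j - 1) := fun x => by
  rw [vecOp_apply]
  exact contract_mem _ (ha x)

theorem gcomm_vecOp_mul (X : Vec I F A) {j : ℤ} {a : Form I F A}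
    (ha : a ∈ (formAlg I F A).deg j) :
    gcomm (-1) j (vecOp X) ((formAlg I F A).mul a) = (formAlg I F A).mul (vecOp X a) :=
  LinearMap.ext fun b => Subtype.ext (funext fun x => by
    change (vecOp X ((formAlg I F A).mul a b)).1 x - (-1 : ℝ) ^ (-1 * j) •
      (a.1 x * (vecOp X b).1 x) = (vecOp X a).1 x * b.1 x
    rw [vecOp_apply, vecOp_apply, vecOp_apply, mul_apply, contract_mul _ (ha x), neg_one_mul,
      zpow_neg, ← inv_zpow, inv_neg_one, add_sub_cancel_right])

theorem vecOp_fnExt (X : Vec I F A) (f : C^∞⟮I, M; ℝ⟯) : vecOp X (fnExt f) = 0 :=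
  Subtype.ext (funext fun x => (vecOp_apply X _ x).trans
    (CliffordAlgebra.contractLeft_algebraMap (Q := (0 : QuadraticForm ℝ (A x →L[ℝ] ℝ)))
      (evalAt x (X x)) (f x)))

theorem vecOp_vecExt (X : Vec I F A) (α : OneForm I F A) :
    vecOp X (vecExt α) = fnExt (pairing α X) :=
  Subtype.ext (funext fun x => (vecOp_apply X _ x).trans
    (CliffordAlgebra.contractLeft_ι (Q := (0 : QuadraticForm ℝ (A x →L[ℝ] ℝ)))
      (evalAt x (X x)) (α x)))

theorem exists_vecOp_eq_mul_comp (f : C^∞⟮I, M; ℝ⟯) (X : Vec I F A) :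
    ∃ Y : Vec I F A, vecOp Y = (formAlg I F A).mul (fnExt f) ∘ₗ vecOp X :=
  ⟨⟨_, f.contMDiff.smul_section X.contMDiff⟩, LinearMap.ext fun u => Subtype.ext (funext fun x => by
    rw [vecOp_apply, LinearMap.comp_apply, mul_apply, vecOp_apply, fnExt_apply, ← Algebra.smul_def]
    change CliffordAlgebra.contractLeft (evalAt x (f x • X x)) _ = _
    rw [map_smul, map_smul, LinearMap.smul_apply])⟩

theorem eq_zero_of_vecOp_eq_zero {j : ℤ} (hj : j ≠ 0) {a : Form I F A}
    (ha : a ∈ (formAlg I F A).deg j) (h : ∀ X, vecOp X a = 0) : a = 0 :=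
  Subtype.ext (funext fun x => eq_zero_of_contractLeft_eq_zero F hj (ha x) fun v => by
    obtain ⟨X, rfl⟩ := exists_section_apply_eq (I := I) (G := F) v
    rw [← vecOp_apply, h]
    rfl)

theorem mul_eq_zero_iff_eq_zero {a : Form I F A} : (formAlg I F A).mul a = 0 ↔ a = 0 :=
  ⟨fun h => (mul_oneExt a).symm.trans (LinearMap.congr_fun h oneExt), fun h => by
    rw [h]
    exact map_zero _⟩

section Derivations

variable {D : Form I F A →ₗ[ℝ] Form I F A}

/-- β(X) is a real-valued function, and a real number with zero square is zero. -/
theorem eq_zero_of_mul_vecOp_eq_zero {β : Form I F A} (hβ : β ∈ (formAlg I F A).deg 1)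
    {X : Vec I F A} (h : (formAlg I F A).mul (vecOp X β) (vecOp X β) = 0) : vecOp X β = 0 := by
  refine Subtype.ext (funext fun x => ?_)
  have h3 : (vecOp X β).1 x * (vecOp X β).1 x = 0 := congrFun (congrArg Subtype.val h) x
  obtain ⟨r, hr⟩ := exists_algebraMap_of_mem_extDeg_zero (vecOp_mem_deg X hβ x)
  rw [hr, ← map_mul] at h3
  have h4 := (ExteriorAlgebra.algebraMap_eq_zero_iff _ _).1 h3
  rw [hr, mul_self_eq_zero.1 h4, map_zero]
  rfl

theorem gcomm_vecOp_fnExt (X : Vec I F A) (f : C^∞⟮I, M; ℝ⟯) :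
    gcomm (-1) 0 (vecOp X) ((formAlg I F A).mul (fnExt f)) = 0 :=
  (gcomm_vecOp_mul X (fnExt_mem f)).trans (mul_eq_zero_iff_eq_zero.2 (vecOp_fnExt X f))

theorem gcomm_vecOp_vecExt (X : Vec I F A) (α : OneForm I F A) :
    gcomm (-1) 1 (vecOp X) ((formAlg I F A).mul (vecExt α)) =
      (formAlg I F A).mul (fnExt (pairing α X)) :=
  (gcomm_vecOp_mul X (vecExt_mem α)).trans (congrArg _ (vecOp_vecExt X α))

/-- A first-order operator of degree one whose iterated commutators with the interior products with
sections of `A` vanish commutes with functions. -/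
theorem gcomm_fnExt_eq_zero (hD : D ∈ (formAlg I F A).ordLT 2 1)
    (h : ∀ X Y : Vec I F A, gcomm (-1 + 1) (-1) (gcomm (-1) 1 (vecOp X) D) (vecOp Y) = 0)
    (f : C^∞⟮I, M; ℝ⟯) : gcomm 1 0 D ((formAlg I F A).mul (fnExt f)) = 0 := by
  obtain ⟨β, hβ, hβD⟩ := (mem_ordLT_one _).1 (((mem_ordLT_add_two _).1 hD).2 0 _ (fnExt_mem f))
  rw [add_zero] at hβ
  rw [← hβD]
  refine mul_eq_zero_iff_eq_zero.2 (eq_zero_of_vecOp_eq_zero one_ne_zero hβ fun X =>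
    eq_zero_of_mul_vecOp_eq_zero hβ ?_)
  -- Write [D, f] = β and L = [i_X, D], so that [L, f] = β(X). Comparing the hypothesis for Y = fX
  -- with the one for Y = X leaves β(X) i_X = 0; applied to β this is β(X)² = 0.
  obtain ⟨Y, hY⟩ := exists_vecOp_eq_mul_comp f X
  have h1 := gcomm_mul_comp_eq_zero hY (h X X) (h X Y)
  have h2 := gcomm_gcomm_deg_zero hβD.symm (gcomm_vecOp_fnExt X f) (gcomm_vecOp_mul X hβ)
  rw [h2] at h1
  exact LinearMap.congr_fun h1 β

/-- [D, α] is a 2-form η. Once D commutes with functions, so do the Lie derivatives [i_X, D], and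
the hypothesis forces i_Y i_X η = 0 for all X and Y. -/
theorem gcomm_vecExt_eq_zero (hD : D ∈ (formAlg I F A).ordLT 2 1)
    (h : ∀ X Y : Vec I F A, gcomm (-1 + 1) (-1) (gcomm (-1) 1 (vecOp X) D) (vecOp Y) = 0)
    (α : OneForm I F A) : gcomm 1 1 D ((formAlg I F A).mul (vecExt α)) = 0 := by
  obtain ⟨η, hη, hηD⟩ := (mem_ordLT_one _).1 (((mem_ordLT_add_two _).1 hD).2 1 _ (vecExt_mem α))
  have hf := gcomm_fnExt_eq_zero hD h
  rw [← hηD]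
  refine mul_eq_zero_iff_eq_zero.2 (eq_zero_of_vecOp_eq_zero (by norm_num) hη fun X =>
    eq_zero_of_vecOp_eq_zero (by norm_num) (vecOp_mem_deg X hη) fun Y =>
      mul_eq_zero_iff_eq_zero.1 ?_)
  exact gcomm_gcomm_deg_one (h X Y) hηD.symm (gcomm_vecOp_vecExt X α) (gcomm_vecOp_vecExt Y α) (hf _)
    (gcomm_gcomm_deg_zero (hf _) (gcomm_vecOp_fnExt X _) (by rw [map_zero]))
    (gcomm_vecOp_mul X hη) (gcomm_vecOp_mul Y (vecOp_mem_deg X hη))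

end Derivations

/-- An element of shifted bidegree `(0, 1)` is determined by its derived bracket. -/
theorem eq_zero_of_derivedBracket_eq_zero {τ : BigAlg I F A} (hτ : τ ∈ (formAlg I F A).hom 1 1)
    (h : ∀ X Y : Vec I F A, derivedBracket τ (ofVec X) (ofVec Y) = 0) : τ = 0 := by
  obtain ⟨D, hD, rfl⟩ := exists_symb hτ
  have h' : ∀ X Y : Vec I F A,
      gcomm (-1 + 1) (-1) (gcomm (-1) 1 (vecOp X) D) (vecOp Y) = 0 := fun X Y => by
    have := h X Y
    rw [derivedBracket, ofVec, ofVec, bracket_symb, bracket_symb, symb_eq_zero] at this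
    -- The vanishing symbol only says that the operator is multiplication by a form. That form has
    -- degree -1, so the operator itself vanishes.
    obtain ⟨q, hq, hq'⟩ := (mem_ordLT_one _).1 this
    exact hq'.symm.trans (mul_eq_zero_iff_eq_zero.2 (eq_zero_of_mem_deg_neg (by norm_num) hq))
  refine (symb_eq_zero hD).2 (mem_ordLT_of_gcomm_mem hD (fun f => ?_) fun α => ?_)
  · exact (Submodule.mem_bot ℝ).2 (gcomm_fnExt_eq_zero hD h' f)
  · exact (Submodule.mem_bot ℝ).2 (gcomm_vecExt_eq_zero hD h' α)

end Symbols

end BigBracket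

namespace BigBracket

/-! ### Identities in the graded Lie algebra: deformation, torsion and concomitant. -/

namespace GCAlg

variable {Ω : Type*} [AddCommGroup Ω] [Module ℝ Ω] {G : GCAlg Ω} {μ N S π : G.SymbAlg}

/-- For w of even degree, bracketing with w on the right is a derivation without signs. -/
theorem bracket_bracket_even {k l m : ℕ} {s t r : ℤ} {u v w : G.SymbAlg} (hu : u ∈ G.hom k s)
    (hv : v ∈ G.hom l t) (hw : w ∈ G.hom m r) (hr : Even r) :
    ⁅⁅u, v⁆, w⁆ = ⁅⁅u, w⁆, v⁆ + ⁅u, ⁅v, w⁆⁆ := by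
  have h := bracket_jacobi_even hw hu hv (hr.mul_right s)
  rw [bracket_skew_even (bracket_mem_hom hu hv) hw (hr.mul_left _), h,
    bracket_skew_even hu hw (hr.mul_left _), bracket_skew_even hv hw (hr.mul_left _), neg_bracket,
    bracket_neg, neg_add]

theorem bracket_bracket_even_odd_eq_zero {k l : ℕ} {s : ℤ} {u : G.SymbAlg} (hu : u ∈ G.hom k s)
    (hs : Even s) (hμ : μ ∈ G.hom l 1) (h : ⁅μ, μ⁆ = 0) : ⁅μ, ⁅u, μ⁆⁆ = 0 := by
  rw [bracket_skew_even hu hμ (hs.mul_right _), bracket_neg,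
    bracket_bracket_self_eq_zero hμ odd_one h hu, neg_zero]

section Deformation

variable (hμ : μ ∈ G.hom 1 1) (hμμ : ⁅μ, μ⁆ = 0) (hN : N ∈ G.hom 1 0) (hπ : π ∈ G.hom 2 (-2))
include hμ hμμ

-- Let γ = {π, μ}. Then {γ, {π, μ}} = {{γ, π}, μ} + {π, {γ, μ}}: the first term dies by the Poisson
-- condition, the second because {μ, {π, μ}} = 0.
include hπ in
theorem bracket_cobracket_self (h : ⁅⁅π, μ⁆, π⁆ = 0) : ⁅⁅π, μ⁆, ⁅π, μ⁆⁆ = 0 := by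
  have hγ := bracket_mem_hom hπ hμ
  rw [bracket_jacobi_even hγ hπ hμ (by norm_num), h, zero_bracket, zero_add,
    bracket_comm_odd hγ hμ (by norm_num), bracket_bracket_even_odd_eq_zero hπ (by norm_num) hμ hμμ,
    bracket_zero]

-- Apply {μ, ·} to {N, {N, μ}} = {S, μ}. By {μ, {S, μ}} = {μ, {N, μ}} = 0, Jacobi leaves only -{{N,
-- μ}, {N, μ}}.
include hN in
theorem bracket_deformed_self (hS : S ∈ G.hom 1 0) (h : ⁅N, ⁅N, μ⁆⁆ = ⁅S, μ⁆) :
    ⁅⁅N, μ⁆, ⁅N, μ⁆⁆ = 0 := by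
  have h0 : ∀ {T}, T ∈ G.hom 1 0 → ⁅μ, ⁅T, μ⁆⁆ = 0 := fun hT =>
    bracket_bracket_even_odd_eq_zero hT (by norm_num) hμ hμμ
  have h1 := bracket_jacobi_even hμ hN (bracket_mem_hom hN hμ) (by norm_num)
  rw [h, h0 hS, h0 hN, bracket_zero, add_zero, bracket_skew_even hμ hN (by norm_num),
    neg_bracket] at h1
  exact neg_eq_zero.1 h1.symm

-- Since μ has zero bracket with {N, μ} and {π, μ}, each half of the concomitant contributes one
-- copy of -{μ_N, γ_π}, these two odd elements being symmetric under the bracket.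
include hN hπ in
theorem bracket_concomitant :
    ⁅μ, ⁅π, ⁅N, μ⁆⁆ + ⁅N, ⁅π, μ⁆⁆⁆ = -((2 : ℝ) • ⁅⁅N, μ⁆, ⁅π, μ⁆⁆) := by
  have hμN := bracket_mem_hom hN hμ
  have hγ := bracket_mem_hom hπ hμ
  rw [bracket_add, bracket_jacobi_even hμ hπ hμN (by norm_num),
    bracket_jacobi_even hμ hN hγ (by norm_num), bracket_bracket_even_odd_eq_zero hN (by norm_num) hμ hμμ,
    bracket_bracket_even_odd_eq_zero hπ (by norm_num) hμ hμμ, bracket_zero, bracket_zero,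
    bracket_skew_even hμ hN (by norm_num), bracket_skew_even hμ hπ (by norm_num), neg_bracket,
    neg_bracket, bracket_comm_odd hγ hμN (by norm_num)]
  module

end Deformation

section Torsion

/-- Bracketing with N differentiates all three entries of the derived bracket, the structure ν
included. -/
theorem derived_bracket_derivation {k : ℕ} {ν X Y : G.SymbAlg} (hN : N ∈ G.hom 1 0)
    (hν : ν ∈ G.hom k 1) (hX : X ∈ G.hom 1 (-1)) (hY : Y ∈ G.hom 1 (-1)) :
    ⁅⁅⁅X, ν⁆, Y⁆, N⁆ = ⁅⁅⁅X, N⁆, ν⁆, Y⁆ + ⁅⁅X, ⁅ν, N⁆⁆, Y⁆ + ⁅⁅X, ν⁆, ⁅Y, N⁆⁆ := by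
  rw [bracket_bracket_even (bracket_mem_hom hX hν) hY hN (by norm_num),
    bracket_bracket_even hX hν hN (by norm_num), add_bracket]

/-- If `S` acts on `X`, `Y` and their derived bracket as applying `N` twice, then twice the Nijenhuis
torsion of `N` is the derived bracket of `{{μ, N}, N} + {μ, S}`. -/
theorem two_smul_torsion {X Y : G.SymbAlg} (hμ : μ ∈ G.hom 1 1) (hN : N ∈ G.hom 1 0)
    (hS : S ∈ G.hom 1 0) (hX : X ∈ G.hom 1 (-1)) (hY : Y ∈ G.hom 1 (-1))
    (hXS : ⁅⁅X, N⁆, N⁆ = ⁅X, S⁆) (hYS : ⁅⁅Y, N⁆, N⁆ = ⁅Y, S⁆)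
    (hXYS : ⁅⁅⁅⁅X, μ⁆, Y⁆, N⁆, N⁆ = ⁅⁅⁅X, μ⁆, Y⁆, S⁆) :
    (2 : ℝ) • (⁅⁅⁅X, N⁆, μ⁆, ⁅Y, N⁆⁆ - ⁅⁅⁅⁅X, N⁆, μ⁆, Y⁆ + ⁅⁅X, μ⁆, ⁅Y, N⁆⁆, N⁆ +
      ⁅⁅⁅⁅X, μ⁆, Y⁆, N⁆, N⁆) = ⁅⁅X, ⁅⁅μ, N⁆, N⁆ + ⁅μ, S⁆⁆, Y⁆ := by
  have hNX : ⁅X, N⁆ ∈ G.hom 1 (-1) := bracket_mem_hom_of_eq hX hN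
  have hNY : ⁅Y, N⁆ ∈ G.hom 1 (-1) := bracket_mem_hom_of_eq hY hN
  have hNμ : ⁅μ, N⁆ ∈ G.hom 1 1 := bracket_mem_hom_of_eq hμ hN
  have h := hXYS
  simp only [derived_bracket_derivation hS hμ hX hY, derived_bracket_derivation hN hμ hX hY,
    derived_bracket_derivation hN hμ hNX hY, derived_bracket_derivation hN hNμ hX hY,
    derived_bracket_derivation hN hμ hX hNY, add_bracket, bracket_add, hXS, hYS] at h ⊢
  -- Expanded, the torsion is [NX, NY] + [NX, Y]' + [X, NY]' + [X, Y]'', with primes for brackets of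
  -- {μ, N} and {{μ, N}, N}. The identity `h`, that S acts on [X, Y] as N twice, expresses twice the
  -- first three terms by the brackets of {μ, S} and {{μ, N}, N}.
  linear_combination (norm := module) h

end Torsion

section Concomitant

variable (hμ : μ ∈ G.hom 1 1) (hN : N ∈ G.hom 1 0) (hπ : π ∈ G.hom 2 (-2))
  (hN0 : ∀ u ∈ G.hom 0 0, ⁅N, u⁆ = 0) (hπ0 : ∀ u ∈ G.hom 0 0, ⁅π, u⁆ = 0)
  (hX0 : ∀ u ∈ G.hom 1 (-1), ∀ v ∈ G.hom 0 0, ⁅u, v⁆ = 0)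

-- Stated for general α because it is used both for 1-forms and for α = μ, where the expression is
-- the concomitant.
include hN hπ in
theorem anticommutator_mem_hom {k l : ℕ} {s t : ℤ} {α : G.SymbAlg} (hα : α ∈ G.hom k s)
    (hk : k + 1 = l) (ht : -2 + s = t) :
    ⁅π, ⁅N, α⁆⁆ + ⁅N, ⁅π, α⁆⁆ ∈ G.hom l t := by
  have hNα : ⁅N, α⁆ ∈ G.hom k s := bracket_mem_hom_of_eq hN hα (by omega) (by omega)
  have hπα : ⁅π, α⁆ ∈ G.hom l t := bracket_mem_hom_of_eq hπ hα (by omega) (by omega)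
  exact add_mem (bracket_mem_hom_of_eq hπ hNα (by omega) (by omega))
    (bracket_mem_hom_of_eq hN hπα (by omega) (by omega))

-- π and N have zero bracket with f, so by Jacobi {·, f} passes through both and acts on μ alone.
include hμ hN hπ hN0 hπ0 in
theorem concomitant_bracket {f : G.SymbAlg} (hf : f ∈ G.hom 0 0) :
    ⁅⁅π, ⁅N, μ⁆⁆ + ⁅N, ⁅π, μ⁆⁆, f⁆ = ⁅π, ⁅N, ⁅μ, f⁆⁆⁆ + ⁅N, ⁅π, ⁅μ, f⁆⁆⁆ := by
  have hμN : ⁅N, μ⁆ ∈ G.hom 1 1 := bracket_mem_hom_of_eq hN hμ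
  have hγ : ⁅π, μ⁆ ∈ G.hom 2 (-1) := bracket_mem_hom_of_eq hπ hμ
  have h1 := bracket_jacobi_even hπ hμN hf (by norm_num)
  have h2 := bracket_jacobi_even hN hγ hf (by norm_num)
  have h3 := bracket_jacobi_even hN hμ hf (by norm_num)
  have h4 := bracket_jacobi_even hπ hμ hf (by norm_num)
  rw [hπ0 f hf, bracket_zero, add_zero] at h1 h4
  rw [hN0 f hf, bracket_zero, add_zero] at h2 h3
  rw [add_bracket, ← h1, ← h2, ← h3, ← h4]

-- By Jacobi, using that order-zero elements commute and that N kills the function {{π, α}, β}. The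
-- resulting formula makes the symmetry in α and β visible.
include hN hπ hN0 in
theorem anticommutator_bracket {α β : G.SymbAlg} (hα : α ∈ G.hom 0 1) (hβ : β ∈ G.hom 0 1) :
    ⁅⁅π, ⁅N, α⁆⁆ + ⁅N, ⁅π, α⁆⁆, β⁆ = -(⁅⁅π, β⁆, ⁅N, α⁆⁆ + ⁅⁅π, α⁆, ⁅N, β⁆⁆) := by
  have hNα : ⁅N, α⁆ ∈ G.hom 0 1 := bracket_mem_hom_of_eq hN hα
  have hπα : ⁅π, α⁆ ∈ G.hom 1 (-1) := bracket_mem_hom_of_eq hπ hα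
  have hπβ : ⁅π, β⁆ ∈ G.hom 1 (-1) := bracket_mem_hom_of_eq hπ hβ
  have h1 := bracket_jacobi_even hπ hNα hβ (by norm_num)
  have h2 := bracket_jacobi_even hN hπα hβ (by norm_num)
  rw [bracket_eq_zero_of_hom_zero hNα hβ, bracket_zero,
    bracket_comm_odd hNα hπβ (by norm_num)] at h1
  rw [hN0 _ (bracket_mem_hom_of_eq hπα hβ)] at h2
  rw [add_bracket]
  linear_combination (norm := module) -h1 - h2

include hN hπ hN0 in
theorem anticommutator_bracket_symm {α β : G.SymbAlg} (hα : α ∈ G.hom 0 1) (hβ : β ∈ G.hom 0 1) :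
    ⁅⁅π, ⁅N, α⁆⁆ + ⁅N, ⁅π, α⁆⁆, β⁆ = ⁅⁅π, ⁅N, β⁆⁆ + ⁅N, ⁅π, β⁆⁆, α⁆ := by
  rw [anticommutator_bracket hN hπ hN0 hα hβ, anticommutator_bracket hN hπ hN0 hβ hα, add_comm]

theorem bracket_bracket_eq_neg {C f : G.SymbAlg} (hμ : μ ∈ G.hom 1 1) (hC : C ∈ G.hom 2 (-1))
    (hμC : ⁅μ, C⁆ = 0) (hf : f ∈ G.hom 0 0) : ⁅C, ⁅μ, f⁆⁆ = -⁅μ, ⁅C, f⁆⁆ := by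
  have := bracket_jacobi_odd hμ hC hf (by norm_num)
  rw [hμC, zero_bracket, zero_sub] at this
  rw [this, neg_neg]

-- Apply {μ, ·} to {{C, f}, g} = 0 and {C, ·} to {{μ, f}, g} = 0. The term {{μ, {C, f}}, g} appears
-- in both with opposite signs, and adding removes it.
include hX0 in
theorem bracket_bracket_skew {C f g : G.SymbAlg} (hμ : μ ∈ G.hom 1 1) (hC : C ∈ G.hom 2 (-1))
    (hμC : ⁅μ, C⁆ = 0) (hf : f ∈ G.hom 0 0) (hg : g ∈ G.hom 0 0) :
    ⁅⁅C, f⁆, ⁅μ, g⁆⁆ = -⁅⁅C, g⁆, ⁅μ, f⁆⁆ := by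
  have hCf : ⁅C, f⁆ ∈ G.hom 1 (-1) := bracket_mem_hom_of_eq hC hf
  have hCg : ⁅C, g⁆ ∈ G.hom 1 (-1) := bracket_mem_hom_of_eq hC hg
  have hdf : ⁅μ, f⁆ ∈ G.hom 0 1 := bracket_mem_hom_of_eq hμ hf
  have h1 := bracket_jacobi_odd hμ hCf hg (by norm_num)
  have h2 := bracket_jacobi_odd hC hdf hg (by norm_num)
  rw [hX0 _ hCf _ hg, bracket_zero] at h1
  rw [bracket_eq_zero_of_hom_zero hdf hg, bracket_zero, bracket_bracket_eq_neg hμ hC hμC hf,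
    neg_bracket, bracket_comm_odd hdf hCg (by norm_num)] at h2
  linear_combination (norm := module) h1 + h2

-- The pairing is symmetric in f and g by the algebra of π and N, and skew by {μ, C} = 0, hence
-- zero.
include hμ hN hπ hN0 hπ0 hX0 in
theorem anticommutator_bracket_eq_zero (hμC : ⁅μ, ⁅π, ⁅N, μ⁆⁆ + ⁅N, ⁅π, μ⁆⁆⁆ = 0) {f g : G.SymbAlg}
    (hf : f ∈ G.hom 0 0) (hg : g ∈ G.hom 0 0) :
    ⁅⁅π, ⁅N, ⁅μ, f⁆⁆⁆ + ⁅N, ⁅π, ⁅μ, f⁆⁆⁆, ⁅μ, g⁆⁆ = 0 := by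
  have h := bracket_bracket_skew hX0 hμ (anticommutator_mem_hom hN hπ hμ rfl rfl) hμC hf hg
  rw [concomitant_bracket hμ hN hπ hN0 hπ0 hf, concomitant_bracket hμ hN hπ hN0 hπ0 hg,
    anticommutator_bracket_symm hN hπ hN0 (bracket_mem_hom_of_eq hμ hg) (bracket_mem_hom_of_eq hμ hf)] at h
  have h2 : (2 : ℝ) • ⁅⁅π, ⁅N, ⁅μ, f⁆⁆⁆ + ⁅N, ⁅π, ⁅μ, f⁆⁆⁆, ⁅μ, g⁆⁆ = 0 := by
    rw [two_smul, ← eq_neg_iff_add_eq_zero]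
    exact h
  exact (smul_eq_zero.1 h2).resolve_left two_ne_zero

end Concomitant

end GCAlg

end BigBracket

namespace BigBracket

theorem GCAlg.gcomm_mem_of_anticommutator_eq_zero {Ω : Type*} [AddCommGroup Ω] [Module ℝ Ω]
    {G : GCAlg Ω} {P T a b : Ω →ₗ[ℝ] Ω} (hP : P ∈ G.ordLT 3 (-2)) (hT : T ∈ G.ordLT 2 0)
    (ha : a ∈ G.ordLT 1 1) (hb : b ∈ G.ordLT 1 1)
    (h : ⁅G.symb 2 (-2) P hP, G.symb 0 1 b hb⁆ +
      ⁅G.symb 1 0 T hT, ⁅G.symb 2 (-2) P hP, G.symb 0 1 a ha⁆⁆ = 0) :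
    gcomm (-2) 1 P b + gcomm 0 (-2 + 1) T (gcomm (-2) 1 P a) ∈ G.ordLT 1 (-1) := by
  rw [bracket_bracket_symb, bracket_symb,
    symb_congr (k := 2 + 0 - 1) (l := 1) (t := -1) _ (by norm_num) (by norm_num) rfl,
    symb_congr (k := 1 + 2 + 0 - 2) (l := 1) (t := -1)
      (P := gcomm 0 (-2 + 1) T (gcomm (-2) 1 P a)) _ (by norm_num) (by norm_num) rfl,
    ← symb_add, symb_eq_zero] at h
  exact h

/-! ### Geometric form of the identities, and the theorem. -/

section Main

open GCAlg

variable {E H M : Type*} [NormedAddCommGroup E] [NormedSpace ℝ E] [FiniteDimensional ℝ E]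
  [TopologicalSpace H] {I : ModelWithCorners ℝ E H} [TopologicalSpace M] [ChartedSpace H M]
  [IsManifold I ∞ M] [T2Space M]
  {F : Type*} [NormedAddCommGroup F] [NormedSpace ℝ F] [FiniteDimensional ℝ F]
  {A : M → Type*} [∀ x, AddCommGroup (A x)] [∀ x, Module ℝ (A x)]
  [TopologicalSpace (Bundle.TotalSpace F A)] [∀ x, TopologicalSpace (A x)]
  [∀ x, IsTopologicalAddGroup (A x)] [∀ x, ContinuousSMul ℝ (A x)]
  [FiberBundle F A] [VectorBundle ℝ F A] [ContMDiffVectorBundle ∞ F A I]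

theorem two_smul_torsion_eq {μ : BigAlg I F A} (hμ : μ ∈ (formAlg I F A).hom 1 1)
    (N : EndTensor I F A) (X Y : Vec I F A) :
    (2 : ℝ) • torsion μ N X Y = derivedBracket (⁅⁅μ, ofTensor N⁆, ofTensor N⁆ +
      ⁅μ, ofTensor (squareTensor N)⁆) (ofVec X) (ofVec Y) := by
  have h1 : ⁅ofVec X, μ⁆ ∈ (formAlg I F A).hom 1 0 := bracket_mem_hom_of_eq (ofVec_mem X) hμ
  have h2 : ⁅⁅ofVec X, μ⁆, ofVec Y⁆ ∈ (formAlg I F A).hom 1 (-1) :=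
    bracket_mem_hom_of_eq h1 (ofVec_mem Y)
  exact two_smul_torsion hμ (ofTensor_mem N) (ofTensor_mem (squareTensor N)) (ofVec_mem X)
    (ofVec_mem Y) (bracket_bracket_ofTensor N (ofVec_mem X))
    (bracket_bracket_ofTensor N (ofVec_mem Y)) (bracket_bracket_ofTensor N h2)

/-- If `N` is a Nijenhuis tensor, then deforming `μ` twice by `N` is deforming it by `N²`. -/
theorem IsNijenhuis.bracket_bracket_eq {μ : BigAlg I F A} (hμ : μ ∈ (formAlg I F A).hom 1 1)
    {N : EndTensor I F A} (hN : IsNijenhuis μ N) :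
    ⁅ofTensor N, ⁅ofTensor N, μ⁆⁆ = ⁅ofTensor (squareTensor N), μ⁆ := by
  have hNμ : ⁅ofTensor N, μ⁆ ∈ (formAlg I F A).hom 1 1 := bracket_mem_hom_of_eq (ofTensor_mem N) hμ
  have h := eq_zero_of_derivedBracket_eq_zero (add_mem (bracket_ofTensor_mem N
    (bracket_ofTensor_mem N hμ)) (bracket_ofTensor_mem (squareTensor N) hμ)) fun X Y => by
      rw [← two_smul_torsion_eq hμ, hN X Y, smul_zero]
  rw [bracket_skew_even hμ (ofTensor_mem N) (by norm_num), neg_bracket,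
    bracket_skew_even hμ (ofTensor_mem (squareTensor N)) (by norm_num),
    bracket_skew_even hNμ (ofTensor_mem N) (by norm_num), neg_neg] at h
  exact add_neg_eq_zero.1 h

theorem gcomm_interiorOp_bivector (π : Bivector I F A) (β : OneForm I F A) (u : Form I F A)
    (x : M) :
    (gcomm (-2) 1 (interiorOp π.val π.smooth) ((formAlg I F A).mul (vecExt β)) u).1 x =
      -CliffordAlgebra.contractLeft (evalAt x (sharp π x (β x))) (u.1 x) := by
  have h := intProd_two_ι_mul (evalAt x) (π.mem x) (β x) (u.1 x)
  change intProd (evalAt x) (π.val x) (ExteriorAlgebra.ι ℝ (β x) * u.1 x) -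
    (-1 : ℝ) ^ (-2 * 1 : ℤ) • (ExteriorAlgebra.ι ℝ (β x) * intProd (evalAt x) (π.val x) (u.1 x)) = _
  rw [h, show (-1 : ℝ) ^ (-2 * 1 : ℤ) = 1 by norm_num, one_smul, sub_sub_cancel_left]
  rfl

theorem gcomm_derOp_gcomm_interiorOp (N : EndTensor I F A) (π : Bivector I F A)
    (β : OneForm I F A) (u : Form I F A) (x : M) :
    (gcomm 0 (-2 + 1) (derOp N) (gcomm (-2) 1 (interiorOp π.val π.smooth)
      ((formAlg I F A).mul (vecExt β))) u).1 x =
      CliffordAlgebra.contractLeft (evalAt x (N x (sharp π x (β x)))) (u.1 x) := by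
  have h1 := gcomm_interiorOp_bivector π β
  generalize gcomm (-2) 1 (interiorOp π.val π.smooth) ((formAlg I F A).mul (vecExt β)) = R at h1 ⊢
  change extDer (transposeAt (N x)) ((R u).1 x) - (-1 : ℝ) ^ (0 * (-2 + 1) : ℤ) •
    (R (derOp N u)).1 x = _
  rw [h1, h1, zero_mul, zpow_zero, one_smul, map_neg, extDer_contractLeft]
  change -(_ - _) - -CliffordAlgebra.contractLeft _ (extDer (transposeAt (N x)) (u.1 x)) = _
  rw [neg_sub, sub_neg_eq_add, sub_add_cancel]
  rfl

/-- The bracket with π turns a 1-form β into -i_{π^♯ β}, and N acts on this with a second sign, so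
the hypothesis is the symbol of i_v = 0 for v = N π^♯ β - π^♯ N* β. An operator of order 0 and
degree -1 is zero, so this holds for operators and can be evaluated on 1-forms. -/
theorem sharp_transpose_eq {N : EndTensor I F A} {π : Bivector I F A} {β : OneForm I F A}
    (h : ⁅ofBivector π, ⁅ofTensor N, ofOneForm β⁆⁆ + ⁅ofTensor N, ⁅ofBivector π, ofOneForm β⁆⁆ = 0)
    (x : M) : N x (sharp π x (β x)) = sharp π x ((β x).comp (N x)) := by
  rw [bracket_ofTensor_ofOneForm] at h
  obtain ⟨q, hq, hqP⟩ := (mem_ordLT_one _).1 (gcomm_mem_of_anticommutator_eq_zero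
    (interiorOp_bivector_mem π) (derOp_mem N) (mul_oneForm_mem β)
    (mul_oneForm_mem (transpose N β)) h)
  have h0 := hqP.symm.trans (mul_eq_zero_iff_eq_zero.2 (eq_zero_of_mem_deg_neg (by norm_num) hq))
  rw [← sub_eq_zero]
  refine eq_zero_of_forall_covector_eq_zero F fun a => ?_
  obtain ⟨α, rfl⟩ := exists_section_apply_eq (I := I) (G := F →L[ℝ] ℝ)
    (B := fun x => A x →L[ℝ] ℝ) a
  have h1 := congrFun (congrArg Subtype.val (LinearMap.congr_fun h0 (vecExt α))) x
  have h2 := gcomm_interiorOp_bivector π (transpose N β) (vecExt α) x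
  have h3 := gcomm_derOp_gcomm_interiorOp N π β (vecExt α) x
  have h4 := (congrArg₂ (· + ·) h2 h3).symm.trans h1
  have h5 : ∀ v : A x, CliffordAlgebra.contractLeft (evalAt x v) ((vecExt α).1 x) =
      algebraMap ℝ (ExteriorAlgebra ℝ (A x →L[ℝ] ℝ)) (α x v) := fun v =>
    CliffordAlgebra.contractLeft_ι (Q := (0 : QuadraticForm ℝ (A x →L[ℝ] ℝ))) (evalAt x v) (α x)
  rw [h5, h5] at h4
  change -_ + _ = (0 : ExteriorAlgebra ℝ (A x →L[ℝ] ℝ)) at h4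
  rw [neg_add_eq_sub, ← map_sub] at h4
  rw [map_sub]
  exact (ExteriorAlgebra.algebraMap_eq_zero_iff _ _).1 h4

/-- The map `π^♯` at a point, as a linear map. -/
def sharpLin (π : Bivector I F A) (x : M) : (A x →L[ℝ] ℝ) →ₗ[ℝ] A x where
  toFun := sharp π x
  map_add' α β := by
    simp only [sharp, ContinuousLinearMap.toLinearMap_add, map_add, LinearMap.add_apply]
  map_smul' c α := by
    simp only [sharp, ContinuousLinearMap.toLinearMap_smul, map_smul, LinearMap.smul_apply,
      RingHom.id_apply]

/-- Both sides are linear in the covector at x, and exact forms span the covectors there. -/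
theorem sharp_comp_eq_of_exact {μ : BigAlg I F A} (hμ : ExactFormsGenerate μ) {N : EndTensor I F A}
    {π : Bivector I F A} (h : ∀ β : OneForm I F A, IsExactOneForm μ β → ∀ x,
      N x (sharp π x (β x)) = sharp π x ((β x).comp (N x))) (x : M) (a : A x →L[ℝ] ℝ) :
    N x (sharp π x a) = sharp π x (a.comp (N x)) := by
  obtain ⟨α, rfl⟩ := exists_section_apply_eq (I := I) (G := F →L[ℝ] ℝ)
    (B := fun x => A x →L[ℝ] ℝ) a
  obtain ⟨U, hU, hα⟩ := hμ x
  obtain ⟨n, g, β, hβ, hα⟩ := hα α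
  suffices hL : ((N x).toLinearMap ∘ₗ sharpLin π x) (α x) =
      (sharpLin π x ∘ₗ transposeAt (N x)) (α x) from hL
  rw [hα x (mem_of_mem_nhds hU), map_sum, map_sum]
  refine Finset.sum_congr rfl fun i _ => ?_
  rw [map_smul, map_smul]
  exact congrArg _ (h (β i) (hβ i) x)

variable {μ : BigAlg I F A} {N : EndTensor I F A} {π : Bivector I F A}

/-- The squares {μ_N, μ_N} and {γ, γ} vanish, so the structure equation is 2{μ_N, γ} = 0, which is
-{μ, C} = 0. -/
theorem isLieBialgebroid_iff (hμ : μ ∈ (formAlg I F A).hom 1 1) (hμμ : ⁅μ, μ⁆ = 0)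
    (hN : IsNijenhuis μ N) (hπ : IsPoisson μ π) :
    IsLieBialgebroid (deformed μ N) (cobracket μ π) ↔ ⁅μ, concomitant μ π N⁆ = 0 := by
  have hμN : ⁅ofTensor N, μ⁆ ∈ (formAlg I F A).hom 1 1 := bracket_mem_hom_of_eq (ofTensor_mem N) hμ
  have hγ : ⁅ofBivector π, μ⁆ ∈ (formAlg I F A).hom 2 (-1) :=
    bracket_mem_hom_of_eq (ofBivector_mem π) hμ
  have h1 := bracket_deformed_self hμ hμμ (ofTensor_mem N) (ofTensor_mem (squareTensor N))
    (hN.bracket_bracket_eq hμ)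
  have h2 := bracket_cobracket_self hμ hμμ (ofBivector_mem π) hπ
  have h3 : ⁅μ, concomitant μ π N⁆ = _ :=
    bracket_concomitant hμ hμμ (ofTensor_mem N) (ofBivector_mem π)
  have h4 : ⁅deformed μ N + cobracket μ π, deformed μ N + cobracket μ π⁆ =
      (2 : ℝ) • ⁅⁅ofTensor N, μ⁆, ⁅ofBivector π, μ⁆⁆ := by
    rw [deformed, cobracket, add_bracket, bracket_add, bracket_add, h1, h2,
      bracket_comm_odd hγ hμN (by norm_num), two_smul, zero_add, add_zero]
  rw [h3, ← h4, neg_eq_zero]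
  refine ⟨fun h => h.2.2, fun h => ⟨?_, ?_, h⟩⟩
  -- Bidegree (k, l) is by definition order k and degree l - k, so (1, 2) and (2, 1) are the pairs
  -- (1, 1) and (2, -1).
  · exact hμN
  · exact hγ

/-- The element has order 1 and degree -1, so functions bracket to zero with it automatically; with
exact 1-forms it does so by the symmetric-and-skew argument. -/
theorem exact_anticommutator_eq_zero (hμ : μ ∈ (formAlg I F A).hom 1 1)
    (hE : ExactFormsGenerate μ) (h : ⁅μ, concomitant μ π N⁆ = 0) (f : C^∞⟮I, M; ℝ⟯) :
    ⁅ofBivector π, ⁅ofTensor N, ⁅μ, (ofFn f : BigAlg I F A)⁆⁆⁆ +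
      ⁅ofTensor N, ⁅ofBivector π, ⁅μ, (ofFn f : BigAlg I F A)⁆⁆⁆ = 0 := by
  have hd : ⁅μ, ofFn f⁆ ∈ (formAlg I F A).hom 0 1 := bracket_mem_hom_of_eq hμ (ofFn_mem f)
  have hm := anticommutator_mem_hom (ofTensor_mem N) (ofBivector_mem π) hd (l := 1) (t := -1)
    (by norm_num) (by norm_num)
  refine exactForms_bracket_eq_zero hE hm (fun g => bracket_vector_eq_zero hm (ofFn_mem g)) ?_
  rintro β ⟨g, hg⟩
  rw [hg]
  exact anticommutator_bracket_eq_zero hμ (ofTensor_mem N) (ofBivector_mem π)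
    (fun _ => bracket_ofTensor_eq_zero N) (fun _ => bracket_ofBivector_eq_zero π)
    (fun _ hu _ => bracket_vector_eq_zero hu) h (ofFn_mem f) (ofFn_mem g)

theorem concomitant_mem (hμ : μ ∈ (formAlg I F A).hom 1 1) :
    concomitant μ π N ∈ (formAlg I F A).hom 2 (-1) :=
  anticommutator_mem_hom (ofTensor_mem N) (ofBivector_mem π) hμ (by norm_num) (by norm_num)

theorem concomitant_bracket_ofFn (hμ : μ ∈ (formAlg I F A).hom 1 1)
    (hE : ExactFormsGenerate μ) (h : ⁅μ, concomitant μ π N⁆ = 0) (f : C^∞⟮I, M; ℝ⟯) :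
    ⁅concomitant μ π N, (ofFn f : BigAlg I F A)⁆ = 0 :=
  (concomitant_bracket hμ (ofTensor_mem N) (ofBivector_mem π)
    (fun _ => bracket_ofTensor_eq_zero N) (fun _ => bracket_ofBivector_eq_zero π)
    (ofFn_mem f)).trans (exact_anticommutator_eq_zero hμ hE h f)

/-- C has zero bracket with functions, hence also with exact forms, because {C, {μ, f}} = -{μ, {C,
f}}; and exact forms generate. -/
theorem concomitant_eq_zero (hμ : μ ∈ (formAlg I F A).hom 1 1)
    (hE : ExactFormsGenerate μ) (h : ⁅μ, concomitant μ π N⁆ = 0) : concomitant μ π N = 0 := by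
  have hCf := concomitant_bracket_ofFn hμ hE h
  refine exactForms_bracket_eq_zero hE (concomitant_mem hμ) hCf ?_
  rintro β ⟨f, hf⟩
  rw [hf, bracket_bracket_eq_neg hμ (concomitant_mem hμ) h (ofFn_mem f), hCf, bracket_zero,
    neg_zero]

theorem isCompatible_of_bracket_eq_zero (hμ : μ ∈ (formAlg I F A).hom 1 1)
    (hE : ExactFormsGenerate μ) (h : ⁅μ, concomitant μ π N⁆ = 0) : IsCompatible μ π N := by
  refine ⟨sharp_comp_eq_of_exact hE ?_, concomitant_eq_zero hμ hE h⟩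
  rintro β ⟨f, hf⟩
  refine sharp_transpose_eq ?_
  rw [hf]
  exact exact_anticommutator_eq_zero hμ hE h f

end Main

end BigBracket

end

theorem mainTheorem6
    {E H M F : Type*} [NormedAddCommGroup E] [NormedSpace ℝ E] [FiniteDimensional ℝ E]
    [TopologicalSpace H] (I : ModelWithCorners ℝ E H) [I.Boundaryless]
    [TopologicalSpace M] [ChartedSpace H M] [IsManifold I ∞ M] [T2Space M]
    [SecondCountableTopology M]
    [NormedAddCommGroup F] [NormedSpace ℝ F] [FiniteDimensional ℝ F]
    (A : M → Type*) [∀ x, AddCommGroup (A x)] [∀ x, Module ℝ (A x)]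
    [TopologicalSpace (Bundle.TotalSpace F A)] [∀ x, TopologicalSpace (A x)]
    [∀ x, IsTopologicalAddGroup (A x)] [∀ x, ContinuousSMul ℝ (A x)]
    [FiberBundle F A] [VectorBundle ℝ F A] [ContMDiffVectorBundle ∞ F A I]
    (μ : BigAlg I F A) (hμ : IsLieAlgebroid μ)
    (N : EndTensor I F A) (hN : IsNijenhuis μ N)
    (π : Bivector I F A) (hπ : IsPoisson μ π) :
    (IsLieBialgebroid (deformed μ N) (cobracket μ π) ↔ ⁅μ, concomitant μ π N⁆ = 0) ∧
    (IsCompatible μ π N → IsLieBialgebroid (deformed μ N) (cobracket μ π)) ∧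
    (ExactFormsGenerate μ →
      (IsPN μ π N ↔ IsLieBialgebroid (deformed μ N) (cobracket μ π))) := by
  have h := isLieBialgebroid_iff hμ.1 hμ.2 hN hπ
  have hC : IsCompatible μ π N → IsLieBialgebroid (deformed μ N) (cobracket μ π) := fun hc =>
    h.2 (by rw [hc.2, GCAlg.bracket_zero])
  exact ⟨h, hC, fun hE => ⟨fun hPN => hC hPN.2.2, fun hB =>
    ⟨hπ, hN, isCompatible_of_bracket_eq_zero hμ.1 hE (h.1 hB)⟩⟩⟩
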